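/- Let $T$ be the infinite binary rooted tree, whose vertices are the finite words over $\{0,1\}$, and for a subgroup $G\le\operatorname{Aut}T$ put $$\dim_H G=\liminf_{m\to\infty}\frac{\log|G/\mathrm{Stab}_G(m)|}{\log|\operatorname{Aut}T/\mathrm{Stab}(m)|},$$ where $\mathrm{Stab}_G(m)$ is the fixator in $G$ of the $m$-th level. Let $n\ge 2$, let $B=(\mathbb Z/2\mathbb Z)^n$, and let $\Omega$ be the set of infinite sequences $\omega=\omega_1\omega_2\dots$ of non-zero elements of the dual space $B^*$. For $\omega\in\Omega$ the spinal group $G_\omega\le\operatorname{Aut}T$ is generated by the automorphism $a$ exchanging the two maximal subtrees and by the automorphisms $b=b_\omega$, $b\in B$, where $b_\omega$ fixes the first level, acts on the subtree below $0$ as $a^{\omega_1(b)}$ and acts on the subtree below $1$ as $b_{\sigma\omega}$, with $\sigma\omega=\omega_2\omega_3\dots$. Let $\operatorname{diminf}(\omega)=\liminf_{k\to\infty}\lim_{m\to\infty}\dim(\sigma^k\omega \bmod m)$, where $\dim(\omega \bmod m)$ is the dimension of the span of the first $m-1$ letters of $\omega$. Put $$D=\{\lambda\in\mathbb R:\ \exists\,\omega\in\Omega,\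 \operatorname{diminf}(\omega)=2,\ \dim_H G_\omega=\lambda\}.$$ Let $C\subset[0,1]$ be the Cantor set obtained from $[0,1]$ by repeatedly removing the (open) second quarter of each remaining interval. Theorem. There are infinitely many affine maps $h_i(x)=p_ix+q_i$ $(i\in\mathbb N)$, with $p_i,q_i\in\mathbb Q$ and $p_i\ne0$, such that $h_i(C)\subseteq D$ for all $i$ and the sets $h_i(C)$ are pairwise disjoint. -/

import Mathlib

namespace Spinal

/-- Automorphisms of the infinite binary rooted tree.  The vertices are the finite words over
`{0, 1}` (`false` is the letter `0`, `true` the letter `1`), the root is the empty word, and a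
vertex `u` lies above `v` when `u` is a prefix of `v`.  A rooted tree automorphism is a bijection
of the vertices preserving this order in both directions. -/
abbrev AutT : Type :=
  (fun u v : List Bool => u <+: v) ≃r (fun u v : List Bool => u <+: v)

/-- The fixator of the `m`-th level of the tree. -/
def levelStab (m : ℕ) : Subgroup AutT where
  carrier := {g | ∀ w : List Bool, w.length = m → g w = w}
  one_mem' := fun _ _ => rfl
  mul_mem' := by
    intro g h hg hh w hw
    change g (h w) = w
    rw [hh w hw, hg w hw]
  inv_mem' := by
    intro g hg w hw
    change g.symm w = w
    rw [RelIso.symm_apply_eq, hg w hw]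

/-- The order of `G mod m = G / Stab_G(m)`, the group induced by `G` on the first `m` levels. -/
noncomputable def cardMod (G : Subgroup AutT) (m : ℕ) : ℕ :=
  Nat.card (G ⧸ (levelStab m).subgroupOf G)

/-- The Hausdorff dimension of a group of tree automorphisms,
`liminf_m log |G mod m| / log |Aut T mod m|`. -/
noncomputable def hausdorffDim (G : Subgroup AutT) : ℝ :=
  Filter.liminf (fun m : ℕ => Real.log (cardMod G m) / Real.log (cardMod ⊤ m)) Filter.atTop

/-- Exchange the two maximal subtrees. -/
def swapFun : List Bool → List Bool
  | [] => []
  | x :: w => (!x) :: w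

theorem swapFun_involutive : Function.Involutive swapFun := by
  intro w
  cases w <;> simp [swapFun]

theorem swapFun_prefix (u v : List Bool) : swapFun u <+: swapFun v ↔ u <+: v := by
  cases u <;> cases v <;> simp [swapFun, List.cons_prefix_cons]

/-- The generator `a` of the root group, as a tree automorphism. -/
def rootSwap : AutT where
  toEquiv := swapFun_involutive.toPerm
  map_rel_iff' := by
    intro u v
    exact swapFun_prefix u v

/-- The level group `B`, the `n`-fold direct power of `C₂`, written additively as a vector space
over the field with two elements. -/
abbrev LevelGroup (n : ℕ) : Type := Fin n → ZMod 2

/-- The set `Ω` of infinite sequences of non-trivial elements of `B*`.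
Sequences are indexed from `0`: `ω.1 i` is the letter `ω_{i+1}`. -/
def Omega (n : ℕ) : Type :=
  {ω : ℕ → Module.Dual (ZMod 2) (LevelGroup n) // ∀ i, ω i ≠ 0}

/-- The shift `σ`, deleting the first letter. -/
def shift {n : ℕ} (ω : Omega n) : Omega n := ⟨fun i => ω.1 (i + 1), fun i => ω.2 (i + 1)⟩

/-- The action of `b ∈ B` on words defined by `ω`: on the subtree below `0` it acts
as `a ^ ω₁(b)`, and on the subtree below `1` as `b` does for the shifted sequence. -/
def levelFun {n : ℕ} (ω : Omega n) (b : LevelGroup n) : List Bool → List Bool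
  | [] => []
  | false :: w => false :: (if ω.1 0 b = 1 then swapFun w else w)
  | true :: w => true :: levelFun (shift ω) b w

theorem levelFun_involutive {n : ℕ} (ω : Omega n) (b : LevelGroup n) :
    Function.Involutive (levelFun ω b) := by
  intro w
  induction w generalizing ω with
  | nil => rfl
  | cons x w ih =>
    cases x
    · by_cases h : ω.1 0 b = 1
      · simp [levelFun, h, swapFun_involutive w]
      · simp [levelFun, h]
    · simp [levelFun, ih]

theorem levelFun_prefix {n : ℕ} (ω : Omega n) (b : LevelGroup n) (u v : List Bool) :
    levelFun ω b u <+: levelFun ω b v ↔ u <+: v := by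
  induction u generalizing ω v with
  | nil => simp [levelFun]
  | cons x u ih =>
    rcases v with _ | ⟨y, v⟩
    · cases x <;> simp [levelFun]
    · by_cases h : ω.1 0 b = 1 <;> cases x <;> cases y <;>
        simp [levelFun, List.cons_prefix_cons, ih, h, swapFun_prefix]

/-- The element `b ∈ B` as a tree automorphism. -/
def levelAut {n : ℕ} (ω : Omega n) (b : LevelGroup n) : AutT where
  toEquiv := (levelFun_involutive ω b).toPerm
  map_rel_iff' := by
    intro u v
    exact levelFun_prefix ω b u v

/-- The spinal group `G_ω`, generated by `A ∪ B` in `Aut T`. -/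
def spinalGroup {n : ℕ} (ω : Omega n) : Subgroup AutT :=
  Subgroup.closure ({rootSwap} ∪ Set.range (levelAut ω))

/-- `dim (ω mod m)`: the dimension of the span of the letters occurring in the prefix of `ω` of
length `m - 1`, which are the letters that matter for the action on the first `m` levels. -/
noncomputable def dimMod {n : ℕ} (ω : Omega n) (m : ℕ) : ℕ :=
  Module.finrank (ZMod 2) (Submodule.span (ZMod 2) {φ | ∃ i : ℕ, i + 1 < m ∧ φ = ω.1 i})

/-- `diminf ω = liminf_k lim_m dim (σ^k ω mod m)`.  The inner sequence is nondecreasing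
and bounded by `n`, so that its limit exists. -/
noncomputable def diminf {n : ℕ} (ω : Omega n) : ℕ :=
  Filter.liminf (fun k : ℕ => Filter.limUnder Filter.atTop (fun m : ℕ => dimMod (shift^[k] ω) m))
    Filter.atTop

/-- The set `D` of Hausdorff dimensions of the spinal groups `G_ω` with `diminf ω = 2`,
for the level group `B = C₂ⁿ`. -/
def dimSet (n : ℕ) : Set ℝ :=
  {x | ∃ ω : Omega n, diminf ω = 2 ∧ hausdorffDim (spinalGroup ω) = x}

/-- The (endpoints of the) closed intervals left at each stage when, starting from `[0, 1]`, the
open second quarter of every interval is removed. -/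
def cantorIntervals : ℕ → Set (ℝ × ℝ)
  | 0 => {(0, 1)}
  | k + 1 => {J | ∃ I ∈ cantorIntervals k,
      J = (I.1, I.1 + (I.2 - I.1) / 4) ∨ J = (I.1 + (I.2 - I.1) / 2, I.2)}

/-- The Cantor set `C` obtained by repeatedly removing the second quarter of each interval. -/
def quarterCantor : Set ℝ := ⋂ k : ℕ, ⋃ I ∈ cantorIntervals k, Set.Icc I.1 I.2

end Spinal

namespace Spinal

/-! ### Automorphisms of the tree and their sections -/

/-! Sequences over two coordinate functionals suffice. Such a sequence is a binary word, and
truncating its spinal group at level `m + 1` gives the finite group `finSpinal u` of the prefix `u`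
of length `m`. The first-level stabilizer in `finSpinal (x :: u)`, viewed as the group of pairs
`levelPairs x u`, projects onto `finSpinal u`. If `x` occurs in `u`, the kernel of the projection is
`kerClosure x u`, the normal closure of the directed generator not seen by `x`
(`one_mem_levelPairs_iff`). Prepending `x` squares the order of this closure
(`card_kerClosure_cons_self`), and where the letter changes the closure has index 8
(`card_finSpinal_cons_not`). Hence the order depends only on the run lengths of the word
(`card_finSpinal_runWord`).

After division by the number of vertices, all runs but the last two contribute through `runRatio`,
and appending a run `r` to them acts as `v ↦ (r + v) / 2 ^ r`. In the coordinate `v = (2 + x) / 3`,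
the runs 2 and 1 act as `x ↦ x / 4` and `x ↦ (1 + x) / 2`, the two contractions generating the
Cantor set. Every point of it is therefore approached by lists of ones and twos, uniformly in the
starting value (`exists_runMap_near`).

Given such a point `x` and `q ≥ 3`, concatenate blocks consisting of an ever better approximating
list, a run 1 and a run `q`. At the ends of the long runs the quotient tends to `((2 + x) / 3 + 2 (q
+ 1)) / 2 ^ (q + 2)`. Elsewhere the last run is some `t < q`, and the quotient is at least `(t + 1)
/ 2 ^ (t + 1) ≥ q / 2 ^ q`, which is larger. So this limit is the dimension
(`hausdorffDim_blockSeq`). Both letters recur forever, so `diminf` is 2. Each `q` yields one affine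
image of the Cantor set, and the images are disjoint because the values decrease with `q`. -/

theorem AutT.prefix_iff (g : AutT) (u v : List Bool) : g u <+: g v ↔ u <+: v := g.map_rel_iff

/-- The order determines the length: a word has one prefix more than letters, and an order
automorphism preserves the number of prefixes. -/
theorem AutT.length_apply (g : AutT) (w : List Bool) : (g w).length = w.length := by
  have key : ∀ w : List Bool, ({u | u <+: w} : Set (List Bool)).ncard = w.length + 1 := by
    intro w
    have : ({u | u <+: w} : Set (List Bool)) = (w.inits.toFinset : Set (List Bool)) := by
      ext u; simp
    rw [this, Set.ncard_coe_finset, List.toFinset_card_of_nodup, List.length_inits]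
    rw [List.nodup_iff_injective_getElem]
    intro i j hij
    have := congrArg List.length hij
    have hi := i.2
    have hj := j.2
    simp only [List.length_inits] at hi hj
    simp only [List.getElem_inits, List.length_take] at this
    ext
    omega
  have h : ({u | u <+: g w} : Set (List Bool)) = g '' {u | u <+: w} := by
    ext u
    constructor
    · intro hu
      refine ⟨g.symm u, ?_, by simp⟩
      rw [Set.mem_ofPred_eq, ← g.prefix_iff]
      simpa using hu
    · rintro ⟨v, hv, rfl⟩
      exact (g.prefix_iff _ _).2 hv
  have h1 := key (g w)
  rw [h, Set.ncard_image_of_injective _ g.injective, key] at h1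
  omega

theorem AutT.ext_apply {g h : AutT} (H : ∀ w, g w = h w) : g = h := RelIso.ext H

theorem AutT.mul_apply (g h : AutT) (w : List Bool) : (g * h) w = g (h w) := rfl

theorem AutT.one_apply (w : List Bool) : (1 : AutT) w = w := rfl

theorem AutT.inv_apply_self (g : AutT) (w : List Bool) : g⁻¹ (g w) = w := g.symm_apply_apply w

theorem AutT.apply_inv_self (g : AutT) (w : List Bool) : g (g⁻¹ w) = w := g.apply_symm_apply w

@[simp] theorem AutT.apply_nil (g : AutT) : g [] = [] :=
  List.length_eq_zero_iff.1 (by simp [g.length_apply])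

/-- The action of `g` below `0` and of `h` below `1`. -/
def pairFun (g h : List Bool → List Bool) : List Bool → List Bool
  | [] => []
  | false :: w => false :: g w
  | true :: w => true :: h w

theorem pairFun_comp (g h g' h' : List Bool → List Bool) (w : List Bool) :
    pairFun g h (pairFun g' h' w) = pairFun (fun w => g (g' w)) (fun w => h (h' w)) w := by
  rcases w with _ | ⟨_ | _, w⟩ <;> rfl

theorem pairFun_id (w : List Bool) : pairFun (fun w => w) (fun w => w) w = w := by
  rcases w with _ | ⟨_ | _, w⟩ <;> rfl

/-- The automorphism acting as `g` below `0` and as `h` below `1`. -/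
def pairAut (g h : AutT) : AutT where
  toFun := pairFun g h
  invFun := pairFun g.symm h.symm
  left_inv := fun w => by simp [pairFun_comp, pairFun_id]
  right_inv := fun w => by simp [pairFun_comp, pairFun_id]
  map_rel_iff' := by
    intro u v
    rcases u with _ | ⟨_ | _, u⟩ <;> rcases v with _ | ⟨_ | _, v⟩ <;>
      simp [pairFun, List.cons_prefix_cons, AutT.prefix_iff]

theorem pairAut_apply (g h : AutT) (w : List Bool) : pairAut g h w = pairFun g h w := rfl

/-- The embedding of `Aut T × Aut T` into `Aut T` as the fixator of the first level. -/
def pair : AutT × AutT →* AutT where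
  toFun p := pairAut p.1 p.2
  map_one' := AutT.ext_apply fun w => pairFun_id w
  map_mul' p q := AutT.ext_apply fun w => by
    rw [AutT.mul_apply, pairAut_apply, pairAut_apply, pairAut_apply, pairFun_comp]
    rfl

@[simp] theorem pair_apply_false (p : AutT × AutT) (w : List Bool) :
    pair p (false :: w) = false :: p.1 w := rfl

@[simp] theorem pair_apply_true (p : AutT × AutT) (w : List Bool) :
    pair p (true :: w) = true :: p.2 w := rfl

@[simp] theorem rootSwap_apply_cons (x : Bool) (w : List Bool) :
    rootSwap (x :: w) = (!x) :: w := rfl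

theorem pair_injective : Function.Injective pair := by
  intro p q h
  refine Prod.ext (AutT.ext_apply fun w => ?_) (AutT.ext_apply fun w => ?_)
  · have := DFunLike.congr_fun h (false :: w)
    simpa using this
  · have := DFunLike.congr_fun h (true :: w)
    simpa using this

theorem rootSwap_mul_self : rootSwap * rootSwap = 1 :=
  AutT.ext_apply fun w => swapFun_involutive w

theorem rootSwap_inv : rootSwap⁻¹ = rootSwap := inv_eq_of_mul_eq_one_left rootSwap_mul_self

theorem pair_mul_rootSwap (p : AutT × AutT) : pair p * rootSwap = rootSwap * pair p.swap := by
  refine AutT.ext_apply fun w => ?_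
  rcases w with _ | ⟨_ | _, w⟩ <;> simp [AutT.mul_apply]

theorem rootSwap_mul_pair_ne (p q : AutT × AutT) : rootSwap * pair p ≠ pair q := by
  intro h
  have := DFunLike.congr_fun h [false]
  simp [AutT.mul_apply] at this

theorem exists_eq_pair_of_fix {g : AutT} (hg : ∀ x, g [x] = [x]) : ∃ p, g = pair p := by
  have hcons : ∀ (f : AutT), (∀ x, f [x] = [x]) → ∀ x w, f (x :: w) = x :: (f (x :: w)).tail := by
    intro f hf x w
    have h1 : [x] <+: f (x :: w) := by
      rw [← hf x, AutT.prefix_iff]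
      simp
    obtain ⟨v, hv⟩ := h1
    rw [← hv]
    rfl
  have hginv : ∀ x, g⁻¹ [x] = [x] := fun x => by
    conv_lhs => rw [← hg x]
    exact g.inv_apply_self _
  let sec : Bool → AutT := fun x =>
    { toFun := fun w => (g (x :: w)).tail
      invFun := fun w => (g⁻¹ (x :: w)).tail
      left_inv := fun w => by
        dsimp only
        rw [← hcons g hg, AutT.inv_apply_self]
        rfl
      right_inv := fun w => by
        dsimp only
        rw [← hcons g⁻¹ hginv, AutT.apply_inv_self]
        rfl
      map_rel_iff' := by
        intro u v
        have h : x :: (g (x :: u)).tail <+: x :: (g (x :: v)).tail ↔ x :: u <+: x :: v := by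
          rw [← hcons g hg, ← hcons g hg, AutT.prefix_iff]
        simpa [List.cons_prefix_cons] using h }
  refine ⟨(sec false, sec true), AutT.ext_apply fun w => ?_⟩
  rcases w with _ | ⟨_ | _, w⟩
  · simp
  · exact hcons g hg _ _
  · exact hcons g hg _ _

theorem exists_eq_pair (g : AutT) : ∃ p, g = pair p ∨ g = rootSwap * pair p := by
  have key : ∀ f : AutT, f [false] = [false] → ∃ p, f = pair p := by
    intro f hf
    refine exists_eq_pair_of_fix fun x => ?_
    cases x
    · exact hf
    · obtain ⟨y, hy⟩ := List.length_eq_one_iff.1 (f.length_apply [true])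
      cases y
      · exact absurd (f.injective (hy.trans hf.symm)) (by simp)
      · exact hy
  obtain ⟨y, hy⟩ := List.length_eq_one_iff.1 (g.length_apply [false])
  cases y
  · obtain ⟨p, hp⟩ := key g hy
    exact ⟨p, Or.inl hp⟩
  · obtain ⟨p, hp⟩ := key (rootSwap * g) (by simp [AutT.mul_apply, hy])
    exact ⟨p, Or.inr (by rw [← hp, ← mul_assoc, rootSwap_mul_self, one_mul])⟩

/-! ### Parity of the activity on a level -/

/-- The parity of the number of vertices of level `j` at which `g` exchanges the subtrees. -/
def activity : ℕ → (List Bool → List Bool) → ZMod 2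
  | 0, g => if g [false] = [false] then 0 else 1
  | j + 1, g => activity j (fun w => (g (false :: w)).tail) +
      activity j (fun w => (g (true :: w)).tail)

theorem activity_zero_pair (p : AutT × AutT) : activity 0 (pair p) = 0 := by
  simp [activity]

theorem activity_zero_rootSwap_mul_pair (p : AutT × AutT) :
    activity 0 (rootSwap * pair p : AutT) = 1 := by
  simp [activity, AutT.mul_apply]

theorem activity_succ_pair (j : ℕ) (p : AutT × AutT) :
    activity (j + 1) (pair p) = activity j p.1 + activity j p.2 := by
  simp [activity]

theorem activity_succ_rootSwap_mul_pair (j : ℕ) (p : AutT × AutT) :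
    activity (j + 1) (rootSwap * pair p : AutT) = activity j p.1 + activity j p.2 := by
  simp [activity, AutT.mul_apply]

/-- A factor permutes the vertices of the level, so the exchanges of the two factors add up vertex
by vertex modulo 2. These homomorphisms are the invariants that separate cosets below. -/
theorem activity_mul (j : ℕ) (g h : AutT) :
    activity j (g * h : AutT) = activity j g + activity j h := by
  have hs : ∀ p q : AutT × AutT, pair p * (rootSwap * pair q) = rootSwap * pair (p.swap * q) := by
    intro p q
    rw [← mul_assoc, pair_mul_rootSwap, mul_assoc, map_mul]
  have hss : ∀ p q : AutT × AutT,
      rootSwap * pair p * (rootSwap * pair q) = pair (p.swap * q) := by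
    intro p q
    rw [mul_assoc, hs, ← mul_assoc, rootSwap_mul_self, one_mul]
  have h2 : (1 : ZMod 2) + 1 = 0 := by decide
  induction j generalizing g h with
  | zero =>
    obtain ⟨p, rfl | rfl⟩ := exists_eq_pair g <;> obtain ⟨q, rfl | rfl⟩ := exists_eq_pair h <;>
      simp only [hs, hss, ← map_mul, mul_assoc, activity_zero_pair,
        activity_zero_rootSwap_mul_pair, h2, add_zero, zero_add]
  | succ j ih =>
    obtain ⟨p, rfl | rfl⟩ := exists_eq_pair g <;> obtain ⟨q, rfl | rfl⟩ := exists_eq_pair h <;>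
      simp only [hs, hss, ← map_mul, mul_assoc, activity_succ_pair,
        activity_succ_rootSwap_mul_pair, ih, Prod.fst_mul, Prod.snd_mul, Prod.fst_swap,
        Prod.snd_swap] <;> ring

@[simp] theorem activity_one (j : ℕ) : activity j (1 : AutT) = 0 := by
  have := activity_mul j 1 1
  simpa using this

theorem activity_inv (j : ℕ) (g : AutT) : activity j (g⁻¹ : AutT) = activity j g := by
  have h := activity_mul j g⁻¹ g
  rw [inv_mul_cancel, activity_one] at h
  rw [eq_neg_of_add_eq_zero_left h.symm, CharTwo.neg_eq]

theorem activity_zero_rootSwap : activity 0 rootSwap = 1 := by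
  simpa using activity_zero_rootSwap_mul_pair 1

theorem activity_succ_rootSwap (j : ℕ) : activity (j + 1) rootSwap = 0 := by
  simpa only [map_one, mul_one, Prod.fst_one, Prod.snd_one, activity_one, add_zero] using
    activity_succ_rootSwap_mul_pair j 1

/-- The automorphisms whose activity on level `j` is even. -/
def evenActivity (j : ℕ) : Subgroup AutT where
  carrier := {g | activity j g = 0}
  one_mem' := activity_one j
  mul_mem' := by
    intro g h hg hh
    rw [Set.mem_ofPred_eq] at *
    rw [activity_mul, hg, hh, add_zero]
  inv_mem' := by
    intro g hg
    rw [Set.mem_ofPred_eq] at *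
    rw [activity_inv, hg]

theorem mem_evenActivity {j : ℕ} {g : AutT} : g ∈ evenActivity j ↔ activity j g = 0 := Iff.rfl

theorem conj_mem_evenActivity {j : ℕ} {g : AutT} (hg : g ∈ evenActivity j) (h : AutT) :
    h * g * h⁻¹ ∈ evenActivity j := by
  rw [mem_evenActivity] at *
  rw [activity_mul, activity_mul, activity_inv, hg, add_zero, CharTwo.add_self_eq_zero]

/-! ### Permutational wreath products inside `Aut T` -/

/-- The group generated by `rootSwap` and the group `E`, acting on the two maximal subtrees. -/
def wreath (E : Subgroup (AutT × AutT)) (hE : ∀ p ∈ E, p.swap ∈ E) : Subgroup AutT where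
  carrier := {g | ∃ p ∈ E, g = pair p ∨ g = rootSwap * pair p}
  one_mem' := ⟨1, E.one_mem, Or.inl (map_one _).symm⟩
  mul_mem' := by
    rintro _ _ ⟨p, hp, rfl | rfl⟩ ⟨q, hq, rfl | rfl⟩
    · exact ⟨p * q, E.mul_mem hp hq, Or.inl (map_mul _ _ _).symm⟩
    · exact ⟨p.swap * q, E.mul_mem (hE p hp) hq, Or.inr (by
        rw [← mul_assoc, pair_mul_rootSwap, mul_assoc, map_mul])⟩
    · exact ⟨p * q, E.mul_mem hp hq, Or.inr (by rw [mul_assoc, map_mul])⟩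
    · refine ⟨p.swap * q, E.mul_mem (hE p hp) hq, Or.inl ?_⟩
      rw [mul_assoc, ← mul_assoc (pair p), pair_mul_rootSwap, mul_assoc, ← mul_assoc,
        rootSwap_mul_self, one_mul, map_mul]
  inv_mem' := by
    rintro _ ⟨p, hp, rfl | rfl⟩
    · exact ⟨p⁻¹, E.inv_mem hp, Or.inl (map_inv _ _).symm⟩
    · refine ⟨p⁻¹.swap, hE _ (E.inv_mem hp), Or.inr ?_⟩
      rw [mul_inv_rev, rootSwap_inv, ← map_inv, pair_mul_rootSwap]

theorem mem_wreath {E : Subgroup (AutT × AutT)} {hE : ∀ p ∈ E, p.swap ∈ E} {g : AutT} :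
    g ∈ wreath E hE ↔ ∃ p ∈ E, g = pair p ∨ g = rootSwap * pair p := Iff.rfl

theorem pair_mem_wreath {E : Subgroup (AutT × AutT)} {hE : ∀ p ∈ E, p.swap ∈ E}
    {p : AutT × AutT} : pair p ∈ wreath E hE ↔ p ∈ E := by
  constructor
  · rintro ⟨q, hq, h | h⟩
    · rwa [pair_injective h]
    · exact absurd h.symm (rootSwap_mul_pair_ne _ _)
  · exact fun h => ⟨p, h, Or.inl rfl⟩

theorem rootSwap_mem_wreath {E : Subgroup (AutT × AutT)} {hE : ∀ p ∈ E, p.swap ∈ E} :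
    rootSwap ∈ wreath E hE := ⟨1, E.one_mem, Or.inr (by simp)⟩

theorem card_eq_two_mul_of_cosets {G : Type*} [Group G] {H N : Subgroup G} {a : G}
    (haN : a ∉ N) (hH : ∀ g, g ∈ H ↔ g ∈ N ∨ a⁻¹ * g ∈ N) : Nat.card H = 2 * Nat.card N := by
  have hf : Function.Bijective (fun q : Bool × N =>
      (⟨if q.1 then a * q.2 else q.2, by
        rw [hH]
        split_ifs
        · right; simp
        · left; simp⟩ : H)) := by
    constructor
    · rintro ⟨x, n⟩ ⟨y, n'⟩ h
      have h := congrArg Subtype.val h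
      have key : ∀ m m' : N, a * (m : G) ≠ m' := by
        intro m m' hm
        apply haN
        rw [eq_mul_inv_of_mul_eq hm]
        exact N.mul_mem m'.2 (N.inv_mem m.2)
      cases x <;> cases y
      · simpa using h
      · exact absurd h.symm (by simpa using key _ _)
      · exact absurd h (by simpa using key _ _)
      · simpa using h
    · rintro ⟨g, hg⟩
      rcases (hH g).1 hg with h | h
      · exact ⟨(false, ⟨g, h⟩), by simp⟩
      · exact ⟨(true, ⟨_, h⟩), by simp⟩
  rw [← Nat.card_eq_of_bijective _ hf, Nat.card_prod]
  simp

theorem card_wreath (E : Subgroup (AutT × AutT)) (hE : ∀ p ∈ E, p.swap ∈ E) :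
    Nat.card (wreath E hE) = 2 * Nat.card E := by
  rw [← Subgroup.card_map_of_injective pair_injective]
  refine card_eq_two_mul_of_cosets (a := rootSwap) ?_ fun g => ?_
  · rintro ⟨p, -, hp⟩
    exact rootSwap_mul_pair_ne 1 p (by simpa using hp.symm)
  · rw [mem_wreath]
    constructor
    · rintro ⟨p, hp, rfl | rfl⟩
      · exact Or.inl ⟨p, hp, rfl⟩
      · exact Or.inr ⟨p, hp, by simp⟩
    · rintro (⟨p, hp, rfl⟩ | ⟨p, hp, h⟩)
      · exact ⟨p, hp, Or.inl rfl⟩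
      · exact ⟨p, hp, Or.inr (by rw [h]; simp)⟩

/-! ### Finite truncations of spinal groups -/

/-- Induction for a subgroup generated by involutions. -/
theorem closure_involutions_induction {G : Type*} [Group G] {S : Set G} {p : G → Prop}
    (hS : ∀ s ∈ S, s * s = 1) (one : p 1) (mul : ∀ s ∈ S, ∀ g, p g → p (s * g))
    {g : G} (hg : g ∈ Subgroup.closure S) : p g := by
  induction hg using Subgroup.closure_induction_left with
  | one => exact one
  | mul_left x hx y _ hy => exact mul x hx y hy
  | inv_mul_cancel x hx y _ hy =>
    rw [inv_eq_of_mul_eq_one_left (hS x hx)]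
    exact mul x hx y hy

/-- The directed automorphism along the rightmost ray acting as `rootSwap` on the subtrees hanging
off this ray at the positions where the letter of the word is `x`. -/
def dir (x : Bool) : List Bool → AutT
  | [] => 1
  | y :: u => pair (if y = x then rootSwap else 1, dir x u)

theorem dir_cons_self (x : Bool) (u : List Bool) : dir x (x :: u) = pair (rootSwap, dir x u) := by
  simp [dir]

theorem dir_not_cons (x : Bool) (u : List Bool) : dir (!x) (x :: u) = pair (1, dir (!x) u) := by
  simp [dir]

theorem dir_mul_self (x : Bool) (u : List Bool) : dir x u * dir x u = 1 := by
  induction u with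
  | nil => simp [dir]
  | cons y u ih =>
    rw [dir, ← map_mul, Prod.mk_mul_mk, ih]
    split_ifs
    · rw [rootSwap_mul_self]
      exact map_one _
    · rw [one_mul]
      exact map_one _

theorem dir_eq_one {x : Bool} {u : List Bool} (h : x ∉ u) : dir x u = 1 := by
  induction u with
  | nil => rfl
  | cons y u ih =>
    simp only [List.mem_cons, not_or] at h
    rw [dir, ih h.2, if_neg (Ne.symm h.1)]
    exact map_one _

theorem activity_zero_dir (x : Bool) (u : List Bool) : activity 0 (dir x u) = 0 := by
  cases u with
  | nil => exact activity_one 0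
  | cons y u => exact activity_zero_pair _

/-- Some level distinguishes the two directed generators if the letter occurs. -/
theorem exists_activity {x : Bool} {u : List Bool} (h : x ∈ u) :
    ∃ j, activity j rootSwap = 0 ∧ activity j (dir x u) = 1 ∧ activity j (dir (!x) u) = 0 := by
  induction u with
  | nil => simp at h
  | cons y u ih =>
    by_cases hy : y = x
    · subst hy
      -- The level is one more than the position of the first `x`: the copy of `rootSwap` sits one
      -- step off the ray.
      refine ⟨1, activity_succ_rootSwap 0, ?_, ?_⟩
      · rw [dir_cons_self, activity_succ_pair, activity_zero_dir, activity_zero_rootSwap, add_zero]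
      · rw [dir_not_cons, activity_succ_pair, activity_zero_dir, activity_one, add_zero]
    · obtain ⟨j, h0, h1, h2⟩ := ih (by simpa [Ne.symm hy] using h)
      have hy' : y = !x := by cases x <;> cases y <;> simp_all
      refine ⟨j + 1, activity_succ_rootSwap j, ?_, ?_⟩
      · rw [dir, if_neg hy, activity_succ_pair, h1, activity_one, zero_add]
      · rw [dir, if_pos hy', activity_succ_pair, h2, h0, zero_add]

/-- The group acting on the first `u.length + 1` levels generated by `rootSwap` and the
two directed automorphisms defined by `u`. -/
def finSpinal (u : List Bool) : Subgroup AutT :=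
  Subgroup.closure {rootSwap, dir true u, dir false u}

theorem finSpinal_eq (x : Bool) (u : List Bool) :
    finSpinal u = Subgroup.closure {rootSwap, dir x u, dir (!x) u} := by
  cases x
  · rw [finSpinal, Set.pair_comm]
    rfl
  · rfl

theorem rootSwap_mem_finSpinal (u : List Bool) : rootSwap ∈ finSpinal u :=
  Subgroup.subset_closure (by simp)

theorem dir_mem_finSpinal (x : Bool) (u : List Bool) : dir x u ∈ finSpinal u := by
  rw [finSpinal_eq x]
  exact Subgroup.subset_closure (by simp)

theorem finSpinal_le {x : Bool} {u : List Bool} {H : Subgroup AutT} (h0 : rootSwap ∈ H)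
    (h1 : dir x u ∈ H) (h2 : dir (!x) u ∈ H) : finSpinal u ≤ H := by
  rw [finSpinal_eq x, Subgroup.closure_le]
  rintro g (rfl | rfl | rfl) <;> assumption

/-- The stabilizer of the first level in `finSpinal (x :: u)`. -/
def levelPairs (x : Bool) (u : List Bool) : Subgroup (AutT × AutT) :=
  Subgroup.closure {(rootSwap, dir x u), (dir x u, rootSwap), (dir (!x) u, 1), (1, dir (!x) u)}

theorem levelPairs_induction {x : Bool} {u : List Bool} {P : AutT × AutT → Prop} (one : P 1)
    (h1 : ∀ q, P q → P ((rootSwap, dir x u) * q)) (h2 : ∀ q, P q → P ((dir x u, rootSwap) * q))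
    (h3 : ∀ q, P q → P ((dir (!x) u, 1) * q)) (h4 : ∀ q, P q → P ((1, dir (!x) u) * q))
    {p : AutT × AutT} (hp : p ∈ levelPairs x u) : P p := by
  refine closure_involutions_induction ?_ one ?_ hp
  · rintro s (rfl | rfl | rfl | rfl) <;> simp [dir_mul_self, rootSwap_mul_self]
  · rintro s (rfl | rfl | rfl | rfl)
    exacts [h1, h2, h3, h4]

theorem rootSwap_dir_mem_levelPairs (x : Bool) (u : List Bool) :
    (rootSwap, dir x u) ∈ levelPairs x u := Subgroup.subset_closure (by simp)

theorem dir_rootSwap_mem_levelPairs (x : Bool) (u : List Bool) :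
    (dir x u, rootSwap) ∈ levelPairs x u := Subgroup.subset_closure (by simp)

theorem dir_one_mem_levelPairs (x : Bool) (u : List Bool) :
    (dir (!x) u, 1) ∈ levelPairs x u := Subgroup.subset_closure (by simp)

theorem one_dir_mem_levelPairs (x : Bool) (u : List Bool) :
    (1, dir (!x) u) ∈ levelPairs x u := Subgroup.subset_closure (by simp)

theorem swap_mem_levelPairs {x : Bool} {u : List Bool} (p : AutT × AutT)
    (hp : p ∈ levelPairs x u) : p.swap ∈ levelPairs x u := by
  refine levelPairs_induction (P := fun p => p.swap ∈ levelPairs x u) (Subgroup.one_mem _)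
    ?_ ?_ ?_ ?_ hp <;> intro q hq
  · exact Subgroup.mul_mem _ (dir_rootSwap_mem_levelPairs x u) hq
  · exact Subgroup.mul_mem _ (rootSwap_dir_mem_levelPairs x u) hq
  · exact Subgroup.mul_mem _ (one_dir_mem_levelPairs x u) hq
  · exact Subgroup.mul_mem _ (dir_one_mem_levelPairs x u) hq

/-- Conjugation by `rootSwap` exchanges coordinates, so the two directed generators and their swaps
generate the first-level stabilizer. -/
theorem finSpinal_cons (x : Bool) (u : List Bool) :
    finSpinal (x :: u) = wreath (levelPairs x u) swap_mem_levelPairs := by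
  apply le_antisymm
  · refine finSpinal_le (x := x) rootSwap_mem_wreath ?_ ?_
    · rw [dir_cons_self, pair_mem_wreath]
      exact rootSwap_dir_mem_levelPairs x u
    · rw [dir_not_cons, pair_mem_wreath]
      exact one_dir_mem_levelPairs x u
  · have hs : ∀ p, pair p ∈ finSpinal (x :: u) → pair p.swap ∈ finSpinal (x :: u) := by
      intro p hp
      have h1 := rootSwap_mem_finSpinal (x :: u)
      have h2 := Subgroup.mul_mem _ (Subgroup.mul_mem _ h1 hp) h1
      rwa [mul_assoc, pair_mul_rootSwap, ← mul_assoc, rootSwap_mul_self, one_mul] at h2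
    have hle : levelPairs x u ≤ (finSpinal (x :: u)).comap pair := by
      have h1 := dir_mem_finSpinal x (x :: u)
      have h2 := dir_mem_finSpinal (!x) (x :: u)
      rw [dir_cons_self] at h1
      rw [dir_not_cons] at h2
      rw [levelPairs, Subgroup.closure_le]
      rintro p (rfl | rfl | rfl | rfl)
      exacts [h1, hs _ h1, hs _ h2, h2]
    rintro g ⟨p, hp, rfl | rfl⟩
    · exact hle hp
    · exact Subgroup.mul_mem _ (rootSwap_mem_finSpinal _) (hle hp)

theorem pair_mem_finSpinal {x : Bool} {u : List Bool} {p : AutT × AutT} :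
    pair p ∈ finSpinal (x :: u) ↔ p ∈ levelPairs x u := by
  rw [finSpinal_cons, pair_mem_wreath]

theorem card_finSpinal_cons (x : Bool) (u : List Bool) :
    Nat.card (finSpinal (x :: u)) = 2 * Nat.card (levelPairs x u) := by
  rw [finSpinal_cons, card_wreath]

theorem levelPairs_le (x : Bool) (u : List Bool) :
    levelPairs x u ≤ (finSpinal u).prod (finSpinal u) := by
  rw [levelPairs, Subgroup.closure_le]
  have h0 := rootSwap_mem_finSpinal u
  have h1 := dir_mem_finSpinal x u
  have h2 := dir_mem_finSpinal (!x) u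
  rintro p (rfl | rfl | rfl | rfl)
  exacts [⟨h0, h1⟩, ⟨h1, h0⟩, ⟨h2, Subgroup.one_mem _⟩, ⟨Subgroup.one_mem _, h2⟩]

theorem map_fst_levelPairs (x : Bool) (u : List Bool) :
    (levelPairs x u).map (MonoidHom.fst AutT AutT) = finSpinal u := by
  apply le_antisymm
  · rintro _ ⟨p, hp, rfl⟩
    exact (levelPairs_le x u hp).1
  · exact finSpinal_le ⟨_, rootSwap_dir_mem_levelPairs x u, rfl⟩
      ⟨_, dir_rootSwap_mem_levelPairs x u, rfl⟩ ⟨_, dir_one_mem_levelPairs x u, rfl⟩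

theorem exists_fst_eq (x : Bool) {u : List Bool} {g : AutT} (hg : g ∈ finSpinal u) :
    ∃ p ∈ levelPairs x u, p.1 = g := by
  rw [← map_fst_levelPairs x] at hg
  exact hg

theorem exists_snd_eq (x : Bool) {u : List Bool} {g : AutT} (hg : g ∈ finSpinal u) :
    ∃ p ∈ levelPairs x u, p.2 = g := by
  obtain ⟨p, hp, h⟩ := exists_fst_eq x hg
  exact ⟨p.swap, swap_mem_levelPairs p hp, h⟩

/-- The normal closure in `finSpinal u` of the directed generator killed by `x`. -/
def kerClosure (x : Bool) (u : List Bool) : Subgroup AutT :=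
  Subgroup.closure {y | ∃ g ∈ finSpinal u, y = g * dir (!x) u * g⁻¹}

theorem conj_mem_kerClosure {x : Bool} {u : List Bool} {g n : AutT} (hg : g ∈ finSpinal u)
    (hn : n ∈ kerClosure x u) : g * n * g⁻¹ ∈ kerClosure x u := by
  have : kerClosure x u ≤ (kerClosure x u).comap (MulAut.conj g).toMonoidHom := by
    conv_lhs => rw [kerClosure]
    rw [Subgroup.closure_le]
    rintro _ ⟨h, hh, rfl⟩
    refine Subgroup.subset_closure ⟨g * h, Subgroup.mul_mem _ hg hh, ?_⟩
    simp [mul_assoc]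
  exact this hn

theorem dir_mem_kerClosure (x : Bool) (u : List Bool) : dir (!x) u ∈ kerClosure x u :=
  Subgroup.subset_closure ⟨1, Subgroup.one_mem _, by simp⟩

theorem kerClosure_le_finSpinal (x : Bool) (u : List Bool) : kerClosure x u ≤ finSpinal u := by
  rw [kerClosure, Subgroup.closure_le]
  rintro _ ⟨g, hg, rfl⟩
  exact Subgroup.mul_mem _ (Subgroup.mul_mem _ hg (dir_mem_finSpinal _ _)) (Subgroup.inv_mem _ hg)

theorem kerClosure_le_evenActivity {x : Bool} {u : List Bool} {j : ℕ}
    (h : activity j (dir (!x) u) = 0) : kerClosure x u ≤ evenActivity j := by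
  rw [kerClosure, Subgroup.closure_le]
  rintro _ ⟨g, -, rfl⟩
  exact conj_mem_evenActivity h g

theorem rootSwap_notMem_kerClosure (x : Bool) (u : List Bool) : rootSwap ∉ kerClosure x u := by
  intro h
  have := kerClosure_le_evenActivity (activity_zero_dir _ _) h
  rw [mem_evenActivity, activity_zero_rootSwap] at this
  exact one_ne_zero this

theorem dir_notMem_kerClosure {x : Bool} {u : List Bool} (hx : x ∈ u) :
    dir x u ∉ kerClosure x u := by
  intro h
  obtain ⟨j, -, h1, h2⟩ := exists_activity hx
  have := kerClosure_le_evenActivity h2 h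
  rw [mem_evenActivity, h1] at this
  exact one_ne_zero this

/-- Since `levelPairs x u` projects onto `finSpinal u`, conjugating `(1, dir (!x) u)` produces every
conjugate in the second coordinate and leaves the first trivial. -/
theorem prod_kerClosure_le (x : Bool) (u : List Bool) :
    (kerClosure x u).prod (kerClosure x u) ≤ levelPairs x u := by
  have h2 : kerClosure x u ≤ (levelPairs x u).comap (MonoidHom.inr AutT AutT) := by
    rw [kerClosure, Subgroup.closure_le]
    rintro _ ⟨g, hg, rfl⟩
    obtain ⟨p, hp, rfl⟩ := exists_snd_eq x hg
    have := Subgroup.mul_mem _ (Subgroup.mul_mem _ hp (one_dir_mem_levelPairs x u))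
      (Subgroup.inv_mem _ hp)
    have h1 : p * (1, dir (!x) u) * p⁻¹ = (1, p.2 * dir (!x) u * p.2⁻¹) :=
      Prod.ext (by simp) rfl
    rwa [h1] at this
  rintro ⟨g, h⟩ ⟨hg, hh⟩
  have := Subgroup.mul_mem _ (swap_mem_levelPairs _ (h2 hg)) (h2 hh)
  simpa using this

/-! ### Orders of the finite spinal groups -/

theorem card_eq_card_map_fst_mul {G H : Type*} [Group G] [Group H] (E : Subgroup (G × H))
    (N : Subgroup H) (hN : ∀ h, h ∈ N ↔ ((1, h) : G × H) ∈ E) :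
    Nat.card E = Nat.card (E.map (MonoidHom.fst G H)) * Nat.card N := by
  let f : E →* G := (MonoidHom.fst G H).comp E.subtype
  have h1 : f.range = E.map (MonoidHom.fst G H) := by
    rw [MonoidHom.range_comp, Subgroup.range_subtype]
  have h2 : Nat.card f.ker = Nat.card N := by
    refine Nat.card_congr
      { toFun := fun p => ⟨p.1.1.2, (hN _).2 ?_⟩
        invFun := fun h => ⟨⟨(1, h.1), (hN _).1 h.2⟩, rfl⟩
        left_inv := ?_
        right_inv := fun h => rfl }
    · have h1 : p.1.1.1 = 1 := p.2
      rw [← h1]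
      exact p.1.2
    · rintro ⟨⟨⟨g, h⟩, hE⟩, hk⟩
      have h1 : g = 1 := hk
      subst h1
      rfl
  rw [← h1, ← h2, ← Subgroup.index_ker, mul_comm, Subgroup.card_mul_index]

/-- With `r = a⁻¹ * d`, the pairs generated live in a dihedral group: each is `(r ^ j, r ^ (-j))` or
a pair of reflections. A reflection is conjugate to `a` or to `d`, hence not in `N`; in the
remaining case the coordinates are mutually inverse. -/
theorem snd_mem_of_fst_mem {G : Type*} [Group G] {F N : Subgroup G} {a d : G} (ha : a * a = 1)
    (hd : d * d = 1) (haF : a ∈ F) (hdF : d ∈ F) (hN : ∀ g ∈ F, ∀ n ∈ N, g * n * g⁻¹ ∈ N)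
    (haN : a ∉ N) (hdN : d ∉ N) {p : G × G} (hp : p ∈ Subgroup.closure {(a, d), (d, a)})
    (h1 : p.1 ∈ N) : p.2 ∈ N := by
  obtain ⟨r, rfl⟩ : ∃ r, d = a * r := ⟨a⁻¹ * d, by simp⟩
  have hainv : a⁻¹ = a := inv_eq_of_mul_eq_one_left ha
  have hrF : r ∈ F := by simpa using F.mul_mem (F.inv_mem haF) hdF
  have hr : ∀ j : ℤ, a * r ^ j = r ^ (-j) * a := by
    have hara : a * r * a⁻¹ = r⁻¹ := by
      rw [hainv]
      apply eq_inv_of_mul_eq_one_left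
      simpa [mul_assoc] using hd
    intro j
    have : (a * r * a⁻¹) ^ j = a * r ^ j * a⁻¹ := conj_zpow
    rw [hara, inv_zpow'] at this
    rw [this, inv_mul_cancel_right]
  have hr1 : ∀ (j : ℤ), a * r * r ^ j = r ^ (-(1 + j)) * a := fun j => by
    rw [mul_assoc, ← zpow_one_add, hr]
  have hform : ∃ j : ℤ, p = (r ^ j, r ^ (-j)) ∨ p = (r ^ j * a, r ^ (-j - 1) * a) := by
    refine closure_involutions_induction (p := fun p : G × G => ∃ j : ℤ,
      p = (r ^ j, r ^ (-j)) ∨ p = (r ^ j * a, r ^ (-j - 1) * a)) ?_ ⟨0, Or.inl (by simp; rfl)⟩ ?_ hp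
    · rintro s (rfl | rfl)
      exacts [Prod.ext ha hd, Prod.ext hd ha]
    · rintro s (rfl | rfl) _ ⟨j, rfl | rfl⟩
      · refine ⟨-j, Or.inr ?_⟩
        rw [Prod.mk_mul_mk, hr, hr1]
        congr 3; ring
      · refine ⟨-j, Or.inl ?_⟩
        rw [Prod.mk_mul_mk, ← mul_assoc, ← mul_assoc, hr, hr1, mul_assoc, mul_assoc, ha, mul_one,
          mul_one]
        congr 2; ring
      · refine ⟨-j - 1, Or.inr ?_⟩
        rw [Prod.mk_mul_mk, hr, hr1]
        congr 3 <;> ring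
      · refine ⟨-j - 1, Or.inl ?_⟩
        rw [Prod.mk_mul_mk, ← mul_assoc, ← mul_assoc, hr, hr1, mul_assoc, mul_assoc, ha, mul_one,
          mul_one]
        congr 2; ring
  obtain ⟨j, rfl | rfl⟩ := hform
  · simpa using N.inv_mem h1
  · exfalso
    dsimp only at h1
    -- For even `j` the reflection `r ^ j * a` is conjugate to `a`, for odd `j` to `d = a * r`.
    obtain ⟨i, rfl | rfl⟩ := Int.even_or_odd' j
    · apply haN
      have := hN _ (F.zpow_mem hrF (-i)) _ h1
      convert this using 1
      rw [mul_assoc, ← zpow_neg, mul_assoc (r ^ (2 * i)), hr, ← mul_assoc, ← mul_assoc,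
        ← zpow_add, ← zpow_add]
      simp
      ring_nf
      simp
    · apply hdN
      have := hN _ (F.mul_mem haF (F.zpow_mem hrF (-i))) _ h1
      convert this using 1
      calc a * r = a * (r ^ (-i) * r ^ (2 * i + 1)) * (r ^ (-i) * a) * a := by
            rw [mul_assoc _ _ a, mul_assoc _ a a, ha, mul_one, mul_assoc, ← zpow_add, ← zpow_add]
            ring_nf
            rw [zpow_one]
        _ = a * r ^ (-i) * (r ^ (2 * i + 1) * a) * (a * r ^ (-i))⁻¹ := by
            rw [← hr, mul_inv_rev, hainv, ← zpow_neg, neg_neg]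
            simp only [mul_assoc]

/-- The generators involving `dir (!x) u` lie in the product of the two closures, which is
normalized by the other two, so they can be collected on the right. -/
theorem exists_mul_of_mem_levelPairs {x : Bool} {u : List Bool} {p : AutT × AutT}
    (hp : p ∈ levelPairs x u) :
    ∃ w ∈ Subgroup.closure {(rootSwap, dir x u), (dir x u, rootSwap)},
      ∃ n ∈ (kerClosure x u).prod (kerClosure x u), p = w * n := by
  set W := Subgroup.closure {(rootSwap, dir x u), (dir x u, rootSwap)}
  have hW : W ≤ (finSpinal u).prod (finSpinal u) := by
    rw [Subgroup.closure_le]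
    have h0 := rootSwap_mem_finSpinal u
    have h1 := dir_mem_finSpinal x u
    rintro p (rfl | rfl)
    exacts [⟨h0, h1⟩, ⟨h1, h0⟩]
  have hn : ∀ n ∈ (kerClosure x u).prod (kerClosure x u), ∀ q : AutT × AutT,
      (∃ w ∈ W, ∃ n ∈ (kerClosure x u).prod (kerClosure x u), q = w * n) →
      ∃ w ∈ W, ∃ n' ∈ (kerClosure x u).prod (kerClosure x u), n * q = w * n' := by
    rintro n hn _ ⟨w, hw, n', hn', rfl⟩
    have hw' := hW (W.inv_mem hw)
    refine ⟨w, hw, (w⁻¹ * n * w⁻¹⁻¹) * n', Subgroup.mul_mem _ ?_ hn', by group⟩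
    exact ⟨conj_mem_kerClosure hw'.1 hn.1, conj_mem_kerClosure hw'.2 hn.2⟩
  have hk := dir_mem_kerClosure x u
  refine levelPairs_induction (P := fun p => ∃ w ∈ W,
      ∃ n ∈ (kerClosure x u).prod (kerClosure x u), p = w * n)
    ⟨1, Subgroup.one_mem _, 1, Subgroup.one_mem _, by simp⟩ ?_ ?_ ?_ ?_ hp
  · rintro _ ⟨w, hw, n, hn, rfl⟩
    exact ⟨_, W.mul_mem (Subgroup.subset_closure (by simp)) hw, n, hn, (mul_assoc _ _ _).symm⟩
  · rintro _ ⟨w, hw, n, hn, rfl⟩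
    exact ⟨_, W.mul_mem (Subgroup.subset_closure (by simp)) hw, n, hn, (mul_assoc _ _ _).symm⟩
  · exact fun q hq => hn _ ⟨hk, Subgroup.one_mem _⟩ q hq
  · exact fun q hq => hn _ ⟨Subgroup.one_mem _, hk⟩ q hq

/-- The occurrence of `x` in `u` keeps `dir x u` out of the closure; `snd_mem_of_fst_mem` then
controls the dihedral factor. -/
theorem one_mem_levelPairs_iff {x : Bool} {u : List Bool} (hx : x ∈ u) (h : AutT) :
    h ∈ kerClosure x u ↔ (1, h) ∈ levelPairs x u := by
  constructor
  · exact fun hh => prod_kerClosure_le x u ⟨Subgroup.one_mem _, hh⟩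
  · intro hh
    obtain ⟨w, hw, n, hn, hwn⟩ := exists_mul_of_mem_levelPairs hh
    have h1 : 1 = w.1 * n.1 := congrArg Prod.fst hwn
    have h2 : h = w.2 * n.2 := congrArg Prod.snd hwn
    rw [h2]
    refine Subgroup.mul_mem _ ?_ hn.2
    refine snd_mem_of_fst_mem rootSwap_mul_self (dir_mul_self x u) (rootSwap_mem_finSpinal u)
      (dir_mem_finSpinal x u) (fun g hg n hn => conj_mem_kerClosure hg hn)
      (rootSwap_notMem_kerClosure x u) (dir_notMem_kerClosure hx) hw ?_
    rw [eq_inv_of_mul_eq_one_left h1.symm]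
    exact Subgroup.inv_mem _ hn.1

theorem card_finSpinal_cons_of_mem {x : Bool} {u : List Bool} (hx : x ∈ u) :
    Nat.card (finSpinal (x :: u)) = 2 * (Nat.card (finSpinal u) * Nat.card (kerClosure x u)) := by
  rw [card_finSpinal_cons, card_eq_card_map_fst_mul _ _ (one_mem_levelPairs_iff hx),
    map_fst_levelPairs]

/-- Here `dir x u = 1`, so the mixed generators become `rootSwap` in a single coordinate and the two
coordinates are independent. -/
theorem card_finSpinal_cons_of_notMem {x : Bool} {u : List Bool} (hx : x ∉ u) :
    Nat.card (finSpinal (x :: u)) = 2 * Nat.card (finSpinal u) ^ 2 := by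
  have hE : levelPairs x u = (finSpinal u).prod (finSpinal u) := by
    refine le_antisymm (levelPairs_le x u) ?_
    have h1 : finSpinal u ≤ (levelPairs x u).comap (MonoidHom.inr AutT AutT) := by
      refine finSpinal_le (x := x) ?_ ?_ (one_dir_mem_levelPairs x u)
      · have := dir_rootSwap_mem_levelPairs x u
        rwa [dir_eq_one hx] at this
      · rw [dir_eq_one hx]
        exact Subgroup.one_mem _
    rintro ⟨g, h⟩ ⟨hg, hh⟩
    have := Subgroup.mul_mem _ (swap_mem_levelPairs _ (h1 hg)) (h1 hh)
    simpa using this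
  rw [card_finSpinal_cons, hE, Nat.card_congr (Subgroup.prodEquiv _ _).toEquiv, Nat.card_prod, sq]

theorem card_finSpinal_nil : Nat.card (finSpinal []) = 2 := by
  rw [card_eq_two_mul_of_cosets (N := ⊥) (a := rootSwap)]
  · simp
  · intro h
    have := activity_zero_rootSwap
    rw [Subgroup.mem_bot.1 h, activity_one] at this
    exact zero_ne_one this
  · intro g
    rw [Subgroup.mem_bot, Subgroup.mem_bot, rootSwap_inv]
    constructor
    · intro hg
      refine closure_involutions_induction (p := fun g => g = 1 ∨ rootSwap * g = 1)
        ?_ (Or.inl rfl) ?_ hg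
      · rintro s (rfl | rfl | rfl) <;> simp [rootSwap_mul_self, dir]
      · rintro s (rfl | rfl | rfl) g h
        · rw [← mul_assoc, rootSwap_mul_self, one_mul]
          exact h.symm
        · simpa [dir] using h
        · simpa [dir] using h
    · rintro (rfl | h)
      · exact Subgroup.one_mem _
      · rw [eq_inv_of_mul_eq_one_right h, rootSwap_inv]
        exact rootSwap_mem_finSpinal _

/-- As `dir x u = 1`, only `rootSwap` survives modulo the closure, and activity at the root shows
that it does survive. -/
theorem card_finSpinal_of_notMem {x : Bool} {u : List Bool} (hx : x ∉ u) :
    Nat.card (finSpinal u) = 2 * Nat.card (kerClosure x u) := by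
  refine card_eq_two_mul_of_cosets (rootSwap_notMem_kerClosure x u) fun g => ?_
  rw [rootSwap_inv]
  constructor
  · intro hg
    rw [finSpinal_eq x] at hg
    refine closure_involutions_induction
      (p := fun g => g ∈ kerClosure x u ∨ rootSwap * g ∈ kerClosure x u)
      ?_ (Or.inl (Subgroup.one_mem _)) ?_ hg
    · rintro s (rfl | rfl | rfl) <;> simp [rootSwap_mul_self, dir_mul_self]
    · rintro s (rfl | rfl | rfl) g h
      · rw [← mul_assoc, rootSwap_mul_self, one_mul]
        exact h.symm
      · rwa [dir_eq_one hx, one_mul]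
      · have hk := dir_mem_kerClosure x u
        refine h.imp (Subgroup.mul_mem _ hk) fun h => ?_
        have := Subgroup.mul_mem _ (conj_mem_kerClosure (rootSwap_mem_finSpinal u) hk) h
        rwa [rootSwap_inv, mul_assoc, ← mul_assoc rootSwap rootSwap, rootSwap_mul_self, one_mul,
          mul_assoc] at this
  · rintro (h | h)
    · exact kerClosure_le_finSpinal x u h
    · have := Subgroup.mul_mem _ (rootSwap_mem_finSpinal u) (kerClosure_le_finSpinal x u h)
      rwa [← mul_assoc, rootSwap_mul_self, one_mul] at this

/-! ### Growth and index of the normal closure -/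

theorem kerClosure_le_map_pair {y x : Bool} {u : List Bool} {Q : Subgroup (AutT × AutT)}
    (hswap : ∀ p ∈ Q, p.swap ∈ Q)
    (h : ∀ p ∈ levelPairs y u, p * (if y = !x then rootSwap else 1, dir (!x) u) * p⁻¹ ∈ Q) :
    kerClosure x (y :: u) ≤ Q.map pair := by
  rw [kerClosure, Subgroup.closure_le]
  intro g hg
  obtain ⟨g, hg, rfl⟩ := hg
  rw [finSpinal_cons] at hg
  obtain ⟨p, hp, rfl | rfl⟩ := hg
  · exact ⟨_, h p hp, by rw [map_mul, map_mul, map_inv, dir]⟩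
  · refine ⟨_, hswap _ (h p hp), ?_⟩
    rw [mul_inv_rev, rootSwap_inv]
    have : ∀ q, pair (Prod.swap q) = rootSwap * pair q * rootSwap := fun q => by
      rw [mul_assoc, pair_mul_rootSwap, ← mul_assoc, rootSwap_mul_self, one_mul]
    rw [this, map_mul, map_mul, map_inv, dir]
    simp only [mul_assoc]

/-- The generator is `(1, dir (!x) u)`, with no swap in the first coordinate, so its conjugates fill
both coordinates independently. -/
theorem card_kerClosure_cons_self (x : Bool) (u : List Bool) :
    Nat.card (kerClosure x (x :: u)) = Nat.card (kerClosure x u) ^ 2 := by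
  have h : kerClosure x (x :: u) = ((kerClosure x u).prod (kerClosure x u)).map pair := by
    apply le_antisymm
    · refine kerClosure_le_map_pair (fun p hp => ⟨hp.2, hp.1⟩) fun p hp => ?_
      rw [if_neg (by simp)]
      refine ⟨by simp, ?_⟩
      exact conj_mem_kerClosure (levelPairs_le x u hp).2 (dir_mem_kerClosure x u)
    · rw [Subgroup.map_le_iff_le_comap]
      have h2 : kerClosure x u ≤
          ((kerClosure x (x :: u)).comap pair).comap (MonoidHom.inr AutT AutT) := by
        conv_lhs => rw [kerClosure]
        rw [Subgroup.closure_le]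
        rintro _ ⟨g, hg, rfl⟩
        obtain ⟨p, hp, rfl⟩ := exists_snd_eq x hg
        have := conj_mem_kerClosure (pair_mem_finSpinal.2 hp) (dir_mem_kerClosure x (x :: u))
        rw [dir_not_cons, ← map_inv, ← map_mul, ← map_mul] at this
        have h1 : p * (1, dir (!x) u) * p⁻¹ = (1, p.2 * dir (!x) u * p.2⁻¹) :=
          Prod.ext (by simp) rfl
        rwa [h1] at this
      rintro ⟨g, h⟩ ⟨hg, hh⟩
      have hs := Subgroup.mul_mem _
        (conj_mem_kerClosure (rootSwap_mem_finSpinal (x :: u)) (h2 hg)) (h2 hh)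
      have hr : ∀ q, rootSwap * pair q * rootSwap⁻¹ = pair q.swap := fun q => by
        rw [rootSwap_inv, mul_assoc, pair_mul_rootSwap, ← mul_assoc, rootSwap_mul_self, one_mul]
      rw [hr, ← map_mul] at hs
      simpa using hs
  rw [h, Subgroup.card_map_of_injective pair_injective,
    Nat.card_congr (Subgroup.prodEquiv _ _).toEquiv, Nat.card_prod, sq]

/-- One factor 2 is the exchange of the subtrees. Inside the first-level stabilizer, the quotient by
the closure is generated by the images of `(dir x u, 1)` and `(1, dir x u)`; the two activity
parities at level `j` show that it has order 4. -/
theorem card_finSpinal_cons_not {x : Bool} {u : List Bool} (hx : x ∈ u) :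
    Nat.card (finSpinal ((!x) :: u)) = 8 * Nat.card (kerClosure x ((!x) :: u)) := by
  obtain ⟨j, ha, hd, hk⟩ := exists_activity hx
  set N := (kerClosure x ((!x) :: u)).comap pair with hNdef
  set E := levelPairs (!x) u with hE
  have hNE : N ≤ E := fun p hp => pair_mem_finSpinal.1 (kerClosure_le_finSpinal _ _ hp)
  have hconj : ∀ p ∈ E, ∀ n ∈ N, p * n * p⁻¹ ∈ N := by
    intro p hp n hn
    rw [hNdef, Subgroup.mem_comap, map_mul, map_mul, map_inv]
    exact conj_mem_kerClosure (pair_mem_finSpinal.2 hp) hn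
  have hle : kerClosure x ((!x) :: u) ≤ ((evenActivity j).prod (evenActivity j)).map pair := by
    refine kerClosure_le_map_pair (fun p hp => ⟨hp.2, hp.1⟩) fun p _ => ?_
    rw [if_pos rfl]
    exact ⟨conj_mem_evenActivity ha _, conj_mem_evenActivity hk _⟩
  have hNeven : ∀ p ∈ N, activity j p.1 = 0 ∧ activity j p.2 = 0 := by
    intro p hp
    obtain ⟨q, hq, h⟩ := hle hp
    rw [← pair_injective h]
    exact hq
  have hN : N.map pair = kerClosure x ((!x) :: u) := by
    rw [hNdef, Subgroup.map_comap_eq, inf_eq_right]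
    intro g hg
    obtain ⟨p, -, rfl⟩ := hle hg
    exact ⟨p, rfl⟩
  have hd1 : (dir x u, 1) ∈ E := by simpa using dir_one_mem_levelPairs (!x) u
  have h1d : (1, dir x u) ∈ E := by simpa using one_dir_mem_levelPairs (!x) u
  have hdd := dir_mul_self x u
  have hdinv := inv_eq_of_mul_eq_one_left hdd
  have hak : (rootSwap, dir (!x) u) ∈ N := by
    have := dir_mem_kerClosure x ((!x) :: u)
    rwa [dir_cons_self] at this
  have hka : (dir (!x) u, rootSwap) ∈ N := by
    have := conj_mem_kerClosure (rootSwap_mem_finSpinal _) (dir_mem_kerClosure x ((!x) :: u))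
    rwa [dir_cons_self, rootSwap_inv, mul_assoc, pair_mul_rootSwap, ← mul_assoc,
      rootSwap_mul_self, one_mul] at this
  -- `(v, w)` represents the inverse of the coset of `p`. The mixed generators lie in `N`; the other
  -- two multiply `v` or `w` by `dir x u`, after a conjugation.
  have hgen : ∀ p ∈ E, ∃ v w : AutT, (v = 1 ∨ v = dir x u) ∧ (w = 1 ∨ w = dir x u) ∧
      p * (v, w) ∈ N := by
    have hmul : ∀ v : AutT, (v = 1 ∨ v = dir x u) → v * dir x u = 1 ∨ v * dir x u = dir x u := by
      rintro v (rfl | rfl)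
      · exact Or.inr (one_mul _)
      · exact Or.inl hdd
    intro p hp
    refine levelPairs_induction (P := fun p => ∃ v w : AutT, (v = 1 ∨ v = dir x u) ∧
      (w = 1 ∨ w = dir x u) ∧ p * (v, w) ∈ N) ⟨1, 1, Or.inl rfl, Or.inl rfl, N.one_mem⟩
      ?_ ?_ ?_ ?_ hp
    · rintro q ⟨v, w, hv, hw, h⟩
      exact ⟨v, w, hv, hw, by rw [mul_assoc]; exact N.mul_mem hak h⟩
    · rintro q ⟨v, w, hv, hw, h⟩
      exact ⟨v, w, hv, hw, by rw [mul_assoc]; exact N.mul_mem hka h⟩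
    · rintro q ⟨v, w, hv, hw, h⟩
      refine ⟨v * dir x u, w, hmul v hv, hw, ?_⟩
      have := hconj _ hd1 _ h
      rw [Bool.not_not]
      convert this using 1
      exact Prod.ext (by simp [mul_assoc, hdinv]) (by simp [mul_assoc, hdinv])
    · rintro q ⟨v, w, hv, hw, h⟩
      refine ⟨v, w * dir x u, hv, hmul w hw, ?_⟩
      have := hconj _ h1d _ h
      rw [Bool.not_not]
      convert this using 1
      exact Prod.ext (by simp [mul_assoc, hdinv]) (by simp [mul_assoc, hdinv])
  -- `E₁` is an intermediate group splitting the index 4 as 2 times 2, one coordinate at a time.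
  set E₁ := E ⊓ (evenActivity j).comap (MonoidHom.fst AutT AutT) with hE₁
  have hEE₁ : Nat.card E = 2 * Nat.card E₁ := by
    refine card_eq_two_mul_of_cosets (a := (dir x u, 1)) ?_ fun g => ?_
    · rintro ⟨-, h⟩
      have : activity j (dir x u) = 0 := h
      rw [hd] at this
      exact one_ne_zero this
    · constructor
      · intro hg
        have h2 : ∀ z : ZMod 2, z = 0 ∨ 1 + z = 0 := by decide
        refine (h2 (activity j g.1)).imp (fun h => ⟨hg, h⟩) fun h => ?_
        refine ⟨E.mul_mem (E.inv_mem hd1) hg, ?_⟩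
        change activity j ((dir x u)⁻¹ * g.1 : AutT) = 0
        rw [activity_mul, activity_inv, hd, h]
      · rintro (h | h)
        · exact h.1
        · have := E.mul_mem hd1 h.1
          rwa [mul_inv_cancel_left] at this
  have hE₁N : Nat.card E₁ = 2 * Nat.card N := by
    refine card_eq_two_mul_of_cosets (a := (1, dir x u)) ?_ fun g => ?_
    · intro h
      have := (hNeven _ h).2
      rw [hd] at this
      exact one_ne_zero this
    · constructor
      · rintro ⟨hg, hg1⟩
        obtain ⟨v, w, hv, hw, h⟩ := hgen g hg
        have hv1 : v = 1 := by
          refine hv.resolve_right ?_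
          rintro rfl
          have h3 : activity j (g.1 * dir x u : AutT) = 0 := (hNeven _ h).1
          have h4 : activity j g.1 = 0 := hg1
          rw [activity_mul, hd, h4] at h3
          simp at h3
        subst hv1
        rcases hw with rfl | rfl
        · left
          rwa [← Prod.one_eq_mk, mul_one] at h
        · right
          have := hconj _ (E.inv_mem h1d) _ h
          have h2 : ((1, dir x u) : AutT × AutT) * (1, dir x u) = 1 := Prod.ext (one_mul _) hdd
          rwa [inv_inv, mul_assoc, mul_assoc, h2, mul_one] at this
      · have hmem : ∀ n ∈ N, n ∈ E₁ := fun n hn => ⟨hNE hn, (hNeven n hn).1⟩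
        rintro (h | h)
        · exact hmem _ h
        · have h1 : ((1, dir x u) : AutT × AutT) ∈ E₁ := ⟨h1d, (evenActivity j).one_mem⟩
          have := E₁.mul_mem h1 (hmem _ h)
          rwa [mul_inv_cancel_left] at this
  rw [card_finSpinal_cons, ← hN, Subgroup.card_map_of_injective pair_injective, ← hE, hEE₁, hE₁N]
  ring

/-! ### Truncation at a level -/

theorem AutT.trunc_prefix (g : AutT) (m : ℕ) {u v : List Bool} (h : u <+: v) :
    g (u.take m) ++ u.drop m <+: g (v.take m) ++ v.drop m := by
  obtain ⟨t, rfl⟩ := h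
  rcases le_total m u.length with hm | hm
  · rw [List.take_append_of_le_length hm, List.drop_append_of_le_length hm, ← List.append_assoc]
    exact List.prefix_append _ _
  · rw [List.take_of_length_le hm, List.drop_of_length_le hm, List.append_nil]
    refine List.IsPrefix.trans ?_ (List.prefix_append _ _)
    rw [AutT.prefix_iff, List.take_append, List.take_of_length_le hm]
    exact List.prefix_append _ _

theorem AutT.trunc_comp (g h : AutT) (m : ℕ) (w : List Bool) :
    g ((h (w.take m) ++ w.drop m).take m) ++ (h (w.take m) ++ w.drop m).drop m =
      g (h (w.take m)) ++ w.drop m := by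
  rcases le_total m w.length with hm | hm
  · have hl : (h (w.take m)).length = m := by
      rw [AutT.length_apply, List.length_take, min_eq_left hm]
    rw [List.take_left' hl, List.drop_left' hl]
  · have hl : (h w).length ≤ m := by rwa [AutT.length_apply]
    rw [List.take_of_length_le hm, List.drop_of_length_le hm, List.append_nil,
      List.take_of_length_le hl, List.drop_of_length_le hl]

/-- The automorphism acting as `g` on the first `m` letters and fixing the others. -/
def truncAut (m : ℕ) (g : AutT) : AutT where
  toFun w := g (w.take m) ++ w.drop m
  invFun w := g⁻¹ (w.take m) ++ w.drop m
  left_inv w := by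
    dsimp only
    rw [AutT.trunc_comp, AutT.inv_apply_self, List.take_append_drop]
  right_inv w := by
    dsimp only
    rw [AutT.trunc_comp, AutT.apply_inv_self, List.take_append_drop]
  map_rel_iff' := by
    intro u v
    refine ⟨fun h => ?_, g.trunc_prefix m⟩
    have := g⁻¹.trunc_prefix m h
    simpa only [Equiv.coe_fn_mk, AutT.trunc_comp, AutT.inv_apply_self, List.take_append_drop]
      using this

theorem truncAut_apply (m : ℕ) (g : AutT) (w : List Bool) :
    truncAut m g w = g (w.take m) ++ w.drop m := rfl

/-- Truncation at level `m`, as an endomorphism of `Aut T`. -/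
def trunc (m : ℕ) : AutT →* AutT where
  toFun := truncAut m
  map_one' := AutT.ext_apply fun w => List.take_append_drop m w
  map_mul' g h := AutT.ext_apply fun w => by
    rw [AutT.mul_apply, truncAut_apply, truncAut_apply, truncAut_apply, AutT.trunc_comp,
      AutT.mul_apply]

theorem trunc_apply (m : ℕ) (g : AutT) (w : List Bool) :
    trunc m g w = g (w.take m) ++ w.drop m := rfl

theorem ker_trunc (m : ℕ) : (trunc m).ker = levelStab m := by
  ext g
  rw [MonoidHom.mem_ker]
  constructor
  · intro h w hw
    have := DFunLike.congr_fun h w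
    rwa [trunc_apply, List.take_of_length_le hw.le, List.drop_of_length_le hw.le,
      List.append_nil] at this
  · intro h
    refine AutT.ext_apply fun w => ?_
    rw [trunc_apply, AutT.one_apply]
    rcases le_total m w.length with hm | hm
    · rw [h _ (by rw [List.length_take, min_eq_left hm]), List.take_append_drop]
    · rw [List.take_of_length_le hm, List.drop_of_length_le hm, List.append_nil]
      -- A shorter word is fixed because it is the prefix, of preserved length, of a padded word on
      -- level `m`.
      have h1 : g w <+: w ++ List.replicate (m - w.length) false := by
        rw [← h (w ++ List.replicate (m - w.length) false) (by simp; omega), AutT.prefix_iff]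
        exact List.prefix_append _ _
      exact (List.prefix_of_prefix_length_le h1 (List.prefix_append _ _)
        (g.length_apply w).le).eq_of_length (g.length_apply w)

/-- Truncation is an endomorphism with kernel the fixator of the level, so the quotient is realized
inside `AutT`. -/
theorem cardMod_eq (G : Subgroup AutT) (m : ℕ) : cardMod G m = Nat.card (G.map (trunc m)) := by
  rw [← Subgroup.relIndex_ker, ker_trunc]
  rfl

theorem trunc_zero (g : AutT) : trunc 0 g = 1 := by
  refine AutT.ext_apply fun w => ?_
  simp [trunc_apply, AutT.one_apply]

theorem trunc_succ_rootSwap (m : ℕ) : trunc (m + 1) rootSwap = rootSwap := by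
  refine AutT.ext_apply fun w => ?_
  rcases w with _ | ⟨x, w⟩ <;> simp [trunc_apply]

theorem trunc_succ_pair (m : ℕ) (p : AutT × AutT) :
    trunc (m + 1) (pair p) = pair (trunc m p.1, trunc m p.2) := by
  refine AutT.ext_apply fun w => ?_
  rcases w with _ | ⟨_ | _, w⟩ <;> simp [trunc_apply]

theorem cardMod_top (m : ℕ) : cardMod ⊤ m = 2 ^ (2 ^ m - 1) := by
  rw [cardMod_eq]
  induction m with
  | zero =>
    have : (⊤ : Subgroup AutT).map (trunc 0) = ⊥ := by
      rw [Subgroup.map_eq_bot_iff]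
      intro g _
      exact trunc_zero g
    rw [this]
    simp
  | succ m ih =>
    set R := (⊤ : Subgroup AutT).map (trunc m) with hR
    have : (⊤ : Subgroup AutT).map (trunc (m + 1)) =
        wreath (R.prod R) (fun p hp => Subgroup.mem_prod.2 (Subgroup.mem_prod.1 hp).symm) := by
      ext g
      rw [mem_wreath]
      constructor
      · rintro ⟨g, -, rfl⟩
        obtain ⟨p, rfl | rfl⟩ := exists_eq_pair g
        · exact ⟨(trunc m p.1, trunc m p.2), ⟨⟨p.1, trivial, rfl⟩, ⟨p.2, trivial, rfl⟩⟩,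
            Or.inl (trunc_succ_pair m p)⟩
        · refine ⟨(trunc m p.1, trunc m p.2), ⟨⟨p.1, trivial, rfl⟩, ⟨p.2, trivial, rfl⟩⟩, Or.inr ?_⟩
          rw [map_mul, trunc_succ_pair, trunc_succ_rootSwap]
      · rintro ⟨⟨x, y⟩, ⟨⟨x, -, rfl⟩, ⟨y, -, rfl⟩⟩, rfl | rfl⟩
        · exact ⟨pair (x, y), trivial, trunc_succ_pair m _⟩
        · exact ⟨rootSwap * pair (x, y), trivial, by
            rw [map_mul, trunc_succ_pair, trunc_succ_rootSwap]⟩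
    rw [this, card_wreath, Nat.card_congr (Subgroup.prodEquiv _ _).toEquiv, Nat.card_prod, ih,
      ← pow_add, ← pow_succ']
    congr 1
    have := Nat.one_le_two_pow (n := m)
    rw [pow_succ]
    omega

/-! ### Spinal groups of sequences over two letters -/

/-- The prefix of length `m` of a sequence. -/
def prefixWord : ℕ → (ℕ → Bool) → List Bool
  | 0, _ => []
  | m + 1, w => w 0 :: prefixWord m (fun i => w (i + 1))

theorem prefixWord_eq (m : ℕ) (w : ℕ → Bool) : prefixWord m w = (List.range m).map w := by
  induction m generalizing w with
  | zero => rfl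
  | succ m ih =>
    rw [prefixWord, ih, List.range_succ_eq_map, List.map_cons, List.map_map]
    rfl

/-- The sequence of coordinate functionals `i₁`, `i₂` chosen by the binary sequence `w`. -/
def coordSeq {n : ℕ} (i₁ i₂ : Fin n) (w : ℕ → Bool) : Omega n :=
  ⟨fun i => LinearMap.proj (if w i then i₁ else i₂), fun i h => by
    have := LinearMap.congr_fun h (fun _ => 1)
    simp at this⟩

theorem coordSeq_apply {n : ℕ} (i₁ i₂ : Fin n) (w : ℕ → Bool) (i : ℕ) (b : LevelGroup n) :
    (coordSeq i₁ i₂ w).1 i b = b (if w i then i₁ else i₂) := rfl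

theorem shift_coordSeq {n : ℕ} (i₁ i₂ : Fin n) (w : ℕ → Bool) :
    shift (coordSeq i₁ i₂ w) = coordSeq i₁ i₂ (fun i => w (i + 1)) := rfl

theorem levelAut_eq_pair {n : ℕ} (ω : Omega n) (b : LevelGroup n) :
    levelAut ω b = pair (if ω.1 0 b = 1 then rootSwap else 1, levelAut (shift ω) b) := by
  refine AutT.ext_apply fun w => ?_
  change levelFun ω b w = _
  rcases w with _ | ⟨_ | _, w⟩
  · simp [levelFun]
  · rw [pair_apply_false, levelFun]
    split_ifs <;> rfl
  · rw [pair_apply_true, levelFun]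
    rfl

/-- Only the coordinates `i₁` and `i₂` of `b` are visible to the letters, and `m` letters govern the
first `m + 1` levels. -/
theorem trunc_levelAut {n : ℕ} (i₁ i₂ : Fin n) (w : ℕ → Bool) (b : LevelGroup n) (m : ℕ) :
    trunc (m + 1) (levelAut (coordSeq i₁ i₂ w) b) =
      (if b i₁ = 1 then dir true (prefixWord m w) else 1) *
        (if b i₂ = 1 then dir false (prefixWord m w) else 1) := by
  induction m generalizing w with
  | zero =>
    have h1 : ∀ x : AutT × AutT, trunc 1 (pair x) = 1 := fun x => by
      rw [trunc_succ_pair, trunc_zero, trunc_zero]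
      exact map_one _
    rw [levelAut_eq_pair, h1, prefixWord]
    simp [dir]
  | succ m ih =>
    have hpair : ∀ (P : Prop) [Decidable P] (q : AutT × AutT),
        (if P then pair q else 1) = pair (if P then q.1 else 1, if P then q.2 else 1) := by
      intro P _ q
      split_ifs
      · rfl
      · exact (map_one _).symm
    rw [levelAut_eq_pair, trunc_succ_pair, shift_coordSeq, ih, prefixWord, dir, dir, hpair, hpair,
      ← map_mul, Prod.mk_mul_mk, coordSeq_apply]
    congr 2
    have h2 : trunc (m + 1) rootSwap = rootSwap := trunc_succ_rootSwap m
    cases w 0 <;> simp only [Bool.false_eq_true, if_true, if_false, reduceCtorEq, ite_self,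
      one_mul, mul_one] <;> split_ifs <;> simp [h2]

theorem map_trunc_spinalGroup {n : ℕ} {i₁ i₂ : Fin n} (hi : i₁ ≠ i₂) (w : ℕ → Bool) (m : ℕ) :
    (spinalGroup (coordSeq i₁ i₂ w)).map (trunc (m + 1)) = finSpinal (prefixWord m w) := by
  apply le_antisymm
  · rw [spinalGroup, Subgroup.map_le_iff_le_comap, Subgroup.closure_le]
    rintro g (rfl | ⟨b, rfl⟩)
    · rw [SetLike.mem_coe, Subgroup.mem_comap, trunc_succ_rootSwap]
      exact rootSwap_mem_finSpinal _
    · rw [SetLike.mem_coe, Subgroup.mem_comap, trunc_levelAut]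
      refine Subgroup.mul_mem _ ?_ ?_ <;> split_ifs
      all_goals first | exact dir_mem_finSpinal _ _ | exact Subgroup.one_mem _
  · have hb : ∀ b, levelAut (coordSeq i₁ i₂ w) b ∈ spinalGroup (coordSeq i₁ i₂ w) := fun b =>
      Subgroup.subset_closure (Or.inr ⟨b, rfl⟩)
    refine finSpinal_le (x := true) ⟨rootSwap, Subgroup.subset_closure (Or.inl rfl),
      trunc_succ_rootSwap m⟩ ⟨_, hb (Pi.single i₁ 1), ?_⟩ ⟨_, hb (Pi.single i₂ 1), ?_⟩
    · rw [trunc_levelAut]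
      simp [hi.symm]
    · rw [trunc_levelAut]
      simp [hi]

theorem cardMod_spinalGroup {n : ℕ} {i₁ i₂ : Fin n} (hi : i₁ ≠ i₂) (w : ℕ → Bool) (m : ℕ) :
    cardMod (spinalGroup (coordSeq i₁ i₂ w)) (m + 1) =
      Nat.card (finSpinal (prefixWord m w)) := by
  rw [cardMod_eq, map_trunc_spinalGroup hi]

/-! ### Orders in terms of run lengths -/

theorem card_kerClosure_replicate_append (x : Bool) (s : ℕ) (v : List Bool) :
    Nat.card (kerClosure x (List.replicate s x ++ v)) = Nat.card (kerClosure x v) ^ 2 ^ s := by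
  induction s with
  | zero => simp
  | succ s ih =>
    rw [List.replicate_succ, List.cons_append, card_kerClosure_cons_self, ih, ← pow_mul, pow_succ]

theorem card_kerClosure_nil (x : Bool) : Nat.card (kerClosure x []) = 1 := by
  have h := card_finSpinal_of_notMem (x := x) (u := []) (by simp)
  rw [card_finSpinal_nil] at h
  omega

/-- The closure over the empty word is trivial, so along a single run each further letter merely
doubles the order. -/
theorem card_finSpinal_replicate (x : Bool) (t : ℕ) :
    Nat.card (finSpinal (List.replicate (t + 1) x)) = 2 ^ (t + 3) := by
  induction t with
  | zero =>
    rw [List.replicate_succ, List.replicate_zero, card_finSpinal_cons_of_notMem (by simp),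
      card_finSpinal_nil]
    norm_num
  | succ t ih =>
    have h := card_kerClosure_replicate_append x (t + 1) []
    rw [List.append_nil, card_kerClosure_nil, one_pow] at h
    rw [List.replicate_succ, card_finSpinal_cons_of_mem (by simp), ih, h]
    ring

theorem card_finSpinal_two_runs (x : Bool) (s t : ℕ) :
    Nat.card (finSpinal (List.replicate (s + 1) x ++ List.replicate (t + 1) (!x))) =
      2 ^ (2 ^ (s + 1) * (t + 2) + s + 3) := by
  set v := List.replicate (t + 1) (!x) with hv
  have hx : x ∉ v := by simp [hv]
  have hF : Nat.card (finSpinal v) = 2 ^ (t + 3) := card_finSpinal_replicate (!x) t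
  have hN : Nat.card (kerClosure x v) = 2 ^ (t + 2) := by
    have h := card_finSpinal_of_notMem hx
    rw [hF] at h
    have : 2 ^ (t + 3) = 2 * 2 ^ (t + 2) := by ring
    omega
  induction s with
  | zero =>
    rw [List.replicate_succ, List.replicate_zero, List.cons_append, List.nil_append,
      card_finSpinal_cons_of_notMem hx, hF]
    ring
  | succ s ih =>
    rw [List.replicate_succ, List.cons_append, card_finSpinal_cons_of_mem (by simp), ih,
      card_kerClosure_replicate_append, hN, ← pow_mul]
    ring

/-- By index 8 the closure starts with exponent `l`, which doubles with each `x`. The sum of `l, 2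
l, 4 l, …`, together with one factor 2 per letter, gives the exponent. -/
theorem card_finSpinal_replicate_append {x : Bool} {v : List Bool} (hx : x ∈ v) {l : ℕ}
    (hl : Nat.card (finSpinal ((!x) :: v)) = 2 ^ (l + 3)) (s : ℕ) :
    Nat.card (finSpinal (List.replicate s x ++ (!x) :: v)) = 2 ^ (2 ^ s * l + s + 3) := by
  have hN : Nat.card (kerClosure x ((!x) :: v)) = 2 ^ l := by
    have h := card_finSpinal_cons_not hx
    rw [hl, pow_add] at h
    omega
  induction s with
  | zero => simpa using hl
  | succ s ih =>
    rw [List.replicate_succ, List.cons_append, card_finSpinal_cons_of_mem (by simp [hx]), ih,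
      card_kerClosure_replicate_append, hN, ← pow_mul]
    ring

/-- The word with the given run lengths and first letter `x`. -/
def runWord : Bool → List ℕ → List Bool
  | _, [] => []
  | x, r :: rs => List.replicate r x ++ runWord (!x) rs

/-- The contribution of the complete runs to the logarithmic order. -/
def runWeight : List ℕ → ℕ
  | [] => 0
  | r :: rs => r + 2 ^ r * runWeight rs

theorem runWord_cons_succ (x : Bool) (r : ℕ) (rs : List ℕ) :
    runWord x ((r + 1) :: rs) = x :: runWord x (r :: rs) := by
  simp [runWord, List.replicate_succ]

theorem length_runWord (x : Bool) (rs : List ℕ) : (runWord x rs).length = rs.sum := by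
  induction rs generalizing x with
  | nil => rfl
  | cons r rs ih => simp [runWord, ih]

theorem exists_runWord_append (x : Bool) (rs : List ℕ) :
    ∃ y, ∀ ss, runWord x (rs ++ ss) = runWord x rs ++ runWord y ss := by
  induction rs generalizing x with
  | nil => exact ⟨x, fun ss => rfl⟩
  | cons r rs ih =>
    obtain ⟨y, hy⟩ := ih (!x)
    exact ⟨y, fun ss => by rw [List.cons_append, runWord, runWord, hy, List.append_assoc]⟩

theorem mem_runWord {x : Bool} {r s : ℕ} (hs : 1 ≤ s) (rs : List ℕ) :
    x ∈ runWord (!x) (r :: s :: rs) := by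
  rw [runWord, runWord, Bool.not_not]
  simp
  omega

/-- The last two runs are kept apart because the index formula needs both letters below the place
where the letter changes. -/
theorem card_finSpinal_runWord (x : Bool) {rs : List ℕ} (hrs : ∀ r ∈ rs, 1 ≤ r) (r t : ℕ) :
    Nat.card (finSpinal (runWord x (rs ++ [r + 1, t + 1]))) =
      2 ^ (runWeight rs + 2 ^ rs.sum * (2 ^ (r + 1) * (t + 2) + r) + 3) := by
  induction rs generalizing x with
  | nil =>
    simp [runWord, runWeight, card_finSpinal_two_runs]
  | cons s rs ih =>
    have ih := ih (!x) (fun r hr => hrs r (List.mem_cons_of_mem _ hr))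
    -- What follows the leading run must begin with `!x` and contain `x` later, so two nonempty runs
    -- are exhibited.
    obtain ⟨k, l, ls, hk, hl⟩ : ∃ k l ls, rs ++ [r + 1, t + 1] = (k + 1) :: l :: ls ∧ 1 ≤ l := by
      rcases rs with _ | ⟨a, _ | ⟨b, rs⟩⟩
      · exact ⟨r, t + 1, [], rfl, by omega⟩
      · have := hrs a (by simp)
        exact ⟨a - 1, r + 1, [t + 1], by simp; omega, by omega⟩
      · have := hrs a (by simp)
        exact ⟨a - 1, b, rs ++ [r + 1, t + 1], by simp; omega, hrs b (by simp)⟩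
    rw [List.cons_append, runWord]
    rw [hk, runWord_cons_succ] at ih ⊢
    rw [card_finSpinal_replicate_append (mem_runWord hl _) ih, runWeight, List.sum_cons]
    ring

theorem exists_take_runWord (x : Bool) {rs : List ℕ} {j : ℕ} (hj : 1 ≤ j) (hj' : j ≤ rs.sum) :
    ∃ ys r zs t, rs = ys ++ r :: zs ∧ 1 ≤ t ∧ t ≤ r ∧
      (runWord x rs).take j = runWord x (ys ++ [t]) := by
  induction rs generalizing x j with
  | nil => simp at hj'; omega
  | cons s rs ih =>
    rcases le_or_gt j s with h | h
    · refine ⟨[], s, rs, j, rfl, hj, h, ?_⟩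
      simp [runWord, List.take_append, h]
    · rw [List.sum_cons] at hj'
      obtain ⟨ys, r, zs, t, rfl, ht, htr, hw⟩ := ih (!x) (j := j - s) (by omega) (by omega)
      refine ⟨s :: ys, r, zs, t, rfl, ht, htr, ?_⟩
      rw [List.cons_append, runWord, runWord, List.take_append, List.length_replicate, hw,
        List.take_of_length_le (by simp; omega)]

/-- The limit of the contributions of the complete runs, normalized by the number of vertices. -/
noncomputable def runRatio (rs : List ℕ) : ℝ := runWeight rs / 2 ^ rs.sum

theorem runWeight_append_singleton (rs : List ℕ) (r : ℕ) :
    runWeight (rs ++ [r]) = runWeight rs + 2 ^ rs.sum * r := by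
  induction rs with
  | nil => simp [runWeight]
  | cons s rs ih =>
    rw [List.cons_append, runWeight, ih, runWeight, List.sum_cons]
    ring

theorem runRatio_append_singleton (rs : List ℕ) (r : ℕ) :
    runRatio (rs ++ [r]) = (r + runRatio rs) / 2 ^ r := by
  rw [runRatio, runRatio, runWeight_append_singleton, List.sum_append, List.sum_singleton]
  push_cast
  rw [pow_add]
  field_simp
  ring

theorem runRatio_nonneg (rs : List ℕ) : 0 ≤ runRatio rs := by
  unfold runRatio
  positivity

theorem runRatio_le_one {rs : List ℕ} (hrs : ∀ r ∈ rs, 1 ≤ r) : runRatio rs ≤ 1 := by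
  induction rs using List.reverseRecOn with
  | nil => simp [runRatio, runWeight]
  | append_singleton rs r ih =>
    have ih := ih fun r hr => hrs r (by simp [hr])
    rw [runRatio_append_singleton, div_le_one (by positivity)]
    have h1 : r + 1 ≤ 2 ^ r := Nat.lt_two_pow_self
    have h2 : (r : ℝ) + 1 ≤ 2 ^ r := by exact_mod_cast h1
    linarith

/-! ### The Cantor set as a set of run length ratios -/

/-- The effect on `runRatio` of appending the given runs in reverse order. -/
noncomputable def runMap (ds : List ℕ) (v : ℝ) : ℝ := ds.foldr (fun r v => (r + v) / 2 ^ r) v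

theorem runRatio_append_reverse (rs ds : List ℕ) :
    runRatio (rs ++ ds.reverse) = runMap ds (runRatio rs) := by
  induction ds with
  | nil => simp [runMap]
  | cons d ds ih =>
    rw [List.reverse_cons, ← List.append_assoc, runRatio_append_singleton, ih]
    simp [runMap]

theorem runMap_append_singleton (ds : List ℕ) (d : ℕ) (v : ℝ) :
    runMap (ds ++ [d]) v = runMap ds ((d + v) / 2 ^ d) := by
  simp [runMap]

/-- A stage-`k` interval is the image of `[2/3, 1]` under some `runMap ds`, transported by `v ↦ 3 v
- 2`. Its left quarter comes from an innermost run 2, its right half from a run 1; each run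
contracts by at least one half. -/
theorem exists_runMap_of_mem_cantorIntervals {k : ℕ} {I : ℝ × ℝ} (hI : I ∈ cantorIntervals k) :
    ∃ ds : List ℕ, (∀ d ∈ ds, d = 1 ∨ d = 2) ∧ ∃ α β : ℝ, 0 ≤ α ∧ α ≤ 1 / 2 ^ k ∧
      (∀ v, runMap ds v = α * v + β) ∧ I = (2 * α + 3 * β - 2, 3 * α + 3 * β - 2) := by
  induction k generalizing I with
  | zero =>
    have hI : I = (0, 1) := hI
    refine ⟨[], by simp, 1, 0, by norm_num, by norm_num, by simp [runMap], ?_⟩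
    rw [hI]
    norm_num
  | succ k ih =>
    obtain ⟨J, hJ, h⟩ := hI
    obtain ⟨ds, hds, α, β, h0, h1, hv, rfl⟩ := ih hJ
    rw [pow_succ]
    have h2 : (1 : ℝ) / (2 ^ k * 2) = 1 / 2 ^ k / 2 := by rw [div_div]
    rw [h2]
    rcases h with rfl | rfl
    · refine ⟨ds ++ [2], by simpa [or_imp, forall_and] using hds, α / 4, α / 2 + β,
        by linarith, by linarith, fun v => ?_, ?_⟩
      · rw [runMap_append_singleton, hv]
        push_cast
        ring
      · ext <;> dsimp only <;> ring
    · refine ⟨ds ++ [1], by simpa [or_imp, forall_and] using hds, α / 2, α / 2 + β,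
        by linarith, by linarith, fun v => ?_, ?_⟩
      · rw [runMap_append_singleton, hv]
        push_cast
        ring
      · ext <;> dsimp only <;> ring

/-- The bound covers all starting values in `[0, 1]`, so an approximating list works after any
earlier runs. -/
theorem exists_runMap_near {x : ℝ} (hx : x ∈ quarterCantor) (k : ℕ) :
    ∃ ds : List ℕ, (∀ d ∈ ds, d = 1 ∨ d = 2) ∧
      ∀ v, 0 ≤ v → v ≤ 1 → |runMap ds v - (2 + x) / 3| ≤ 1 / 2 ^ k := by
  have hx := Set.mem_iInter.1 hx k
  obtain ⟨I, hI, h1, h2⟩ := Set.mem_iUnion₂.1 hx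
  obtain ⟨ds, hds, α, β, h0, hα, hv, rfl⟩ := exists_runMap_of_mem_cantorIntervals hI
  refine ⟨ds, hds, fun v hv0 hv1 => ?_⟩
  dsimp only at h1 h2
  have h3 : 0 ≤ α * v := mul_nonneg h0 hv0
  have h4 : α * v ≤ α := mul_le_of_le_one_right h0 hv1
  rw [hv, abs_le]
  constructor <;> linarith

theorem quarterCantor_subset : quarterCantor ⊆ Set.Icc 0 1 := by
  intro x hx
  have hx := Set.mem_iInter.1 hx 0
  simpa [cantorIntervals] using hx

/-! ### Sequences with prescribed runs -/

/-- The first `N` blocks of runs: each block lists `ds k` in reverse order and ends with a run of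
length one and a long run. -/
def blockRuns (q : ℕ) (ds : ℕ → List ℕ) : ℕ → List ℕ
  | 0 => []
  | N + 1 => blockRuns q ds N ++ ((ds N).reverse ++ [1, q])

theorem le_sum_blockRuns (q : ℕ) (ds : ℕ → List ℕ) (N : ℕ) : N ≤ (blockRuns q ds N).sum := by
  induction N with
  | zero => exact Nat.zero_le _
  | succ N ih => simp [blockRuns]; omega

theorem one_le_of_mem_blockRuns {q : ℕ} (hq : 3 ≤ q) {ds : ℕ → List ℕ}
    (hds : ∀ k, ∀ d ∈ ds k, d = 1 ∨ d = 2) {N r : ℕ} (hr : r ∈ blockRuns q ds N) : 1 ≤ r := by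
  induction N with
  | zero => simp [blockRuns] at hr
  | succ N ih =>
    simp only [blockRuns, List.mem_append, List.mem_reverse, List.mem_cons, List.not_mem_nil,
      or_false] at hr
    rcases hr with hr | hr | rfl | rfl
    · exact ih hr
    · have := hds N r hr
      omega
    · exact le_rfl
    · omega

theorem blockRuns_prefix (q : ℕ) (ds : ℕ → List ℕ) {M N : ℕ} (h : M ≤ N) :
    runWord true (blockRuns q ds M) <+: runWord true (blockRuns q ds N) := by
  induction N, h using Nat.le_induction with
  | base => exact List.prefix_rfl
  | succ N _ ih =>
    obtain ⟨y, hy⟩ := exists_runWord_append true (blockRuns q ds N)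
    rw [blockRuns, hy]
    exact ih.trans (List.prefix_append _ _)

/-- The infinite word with runs `blockRuns q ds`. -/
def blockSeq (q : ℕ) (ds : ℕ → List ℕ) (i : ℕ) : Bool :=
  (runWord true (blockRuns q ds (i + 1))).getD i false

/-- The stages are nested and stage `i + 1` has more than `i` letters, so the default of `getD` is
never used. -/
theorem blockSeq_eq (q : ℕ) (ds : ℕ → List ℕ) {N i : ℕ}
    (hi : i < (runWord true (blockRuns q ds N)).length) :
    blockSeq q ds i = (runWord true (blockRuns q ds N))[i] := by
  have hi' : i < (runWord true (blockRuns q ds (i + 1))).length := by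
    rw [length_runWord]
    exact le_sum_blockRuns q ds (i + 1)
  rw [blockSeq, List.getD_eq_getElem _ _ hi']
  rcases le_total N (i + 1) with h | h
  · exact ((blockRuns_prefix q ds h).getElem hi).symm
  · exact (blockRuns_prefix q ds h).getElem hi'

theorem prefixWord_blockSeq (q : ℕ) (ds : ℕ → List ℕ) {N m : ℕ}
    (hm : m ≤ (blockRuns q ds N).sum) :
    prefixWord m (blockSeq q ds) = (runWord true (blockRuns q ds N)).take m := by
  rw [prefixWord_eq]
  refine List.ext_getElem (by simp [length_runWord, hm]) fun i h1 h2 => ?_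
  rw [List.getElem_map, List.getElem_range, List.getElem_take, blockSeq_eq]

/-- The two adjacent runs closing a block already contain both letters. -/
theorem exists_blockSeq_eq {q : ℕ} (hq : 1 ≤ q) (ds : ℕ → List ℕ) (k : ℕ) (x : Bool) :
    ∃ i, k ≤ i ∧ blockSeq q ds i = x := by
  obtain ⟨y, hy⟩ := exists_runWord_append true (blockRuns q ds k ++ (ds k).reverse)
  have h1 : runWord true (blockRuns q ds (k + 1)) =
      runWord true (blockRuns q ds k ++ (ds k).reverse) ++ runWord y [1, q] := by
    rw [← hy, blockRuns, List.append_assoc]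
  have hmem : x ∈ runWord y [1, q] := by
    rw [runWord, runWord]
    cases x <;> cases y <;> simp <;> omega
  obtain ⟨i, hi, hx⟩ := List.getElem_of_mem hmem
  refine ⟨(runWord true (blockRuns q ds k ++ (ds k).reverse)).length + i, ?_, ?_⟩
  · rw [length_runWord, List.sum_append]
    have := le_sum_blockRuns q ds k
    omega
  · rw [blockSeq_eq q ds (N := k + 1) (by rw [h1, List.length_append]; omega)]
    simp only [h1]
    rw [List.getElem_append_right (by omega)]
    simpa using hx

theorem exists_block {q : ℕ} (ds : ℕ → List ℕ) (j : ℕ) :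
    ∃ N, (blockRuns q ds N).sum ≤ j ∧ j < (blockRuns q ds (N + 1)).sum := by
  have hex : ∃ N, j < (blockRuns q ds N).sum := ⟨j + 1, le_sum_blockRuns q ds (j + 1)⟩
  classical
  obtain ⟨N, hN⟩ : ∃ N, Nat.find hex = N + 1 := by
    refine Nat.exists_eq_succ_of_ne_zero fun h => ?_
    have := Nat.find_spec hex
    rw [h] at this
    simp [blockRuns] at this
  refine ⟨N, not_lt.1 (Nat.find_min hex (by omega)), ?_⟩
  rw [← hN]
  exact Nat.find_spec hex

/-- The shape of a prefix ending inside a block. -/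
theorem prefixWord_blockSeq_runs {q : ℕ} (hq : 3 ≤ q) {ds : ℕ → List ℕ}
    (hds : ∀ k, ∀ d ∈ ds k, d = 1 ∨ d = 2) {N m : ℕ} (h1 : (blockRuns q ds N).sum < m)
    (h2 : m ≤ (blockRuns q ds (N + 1)).sum) :
    ∃ ys t, 1 ≤ t ∧ (∀ r ∈ ys, 1 ≤ r) ∧ (t < q ∨ t = q ∧ ys = (ds N).reverse ++ [1]) ∧
      prefixWord m (blockSeq q ds) = runWord true (blockRuns q ds N ++ ys ++ [t]) := by
  obtain ⟨y, hy⟩ := exists_runWord_append true (blockRuns q ds N)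
  set B := (ds N).reverse ++ [1, q] with hB
  have hsum : (blockRuns q ds (N + 1)).sum = (blockRuns q ds N).sum + B.sum := by
    rw [blockRuns, List.sum_append]
  obtain ⟨ys, r, zs, t, hBeq, ht, htr, htake⟩ := exists_take_runWord y (rs := B)
    (j := m - (blockRuns q ds N).sum) (by omega) (by omega)
  have hmemB : ∀ r ∈ B, r = 1 ∨ r = 2 ∨ r = q := by
    intro r hr
    simp only [hB, List.mem_append, List.mem_reverse, List.mem_cons, List.not_mem_nil,
      or_false] at hr
    rcases hr with hr | rfl | rfl
    · have := hds N r hr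
      omega
    · simp
    · simp
  refine ⟨ys, t, ht, fun r hr => ?_, ?_, ?_⟩
  · have := hmemB r (by rw [hBeq]; simp [hr])
    omega
  -- If nothing follows the cut run, the cut lies in the long run; otherwise the cut run has length
  -- at most 2, hence below `q`.
  · rcases List.eq_nil_or_concat zs with rfl | ⟨zs, z, rfl⟩
    · have hr : ys ++ [r] = ((ds N).reverse ++ [1]) ++ [q] := by
        rw [← hBeq, hB]
        simp
      obtain ⟨h3, h4⟩ := List.append_inj' hr rfl
      have h4 : r = q := by simpa using h4
      subst h4
      rcases htr.lt_or_eq with h | h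
      · exact Or.inl h
      · exact Or.inr ⟨h, h3⟩
    · left
      have hr : (ys ++ r :: zs) ++ [z] = ((ds N).reverse ++ [1]) ++ [q] := by
        rw [List.append_assoc, List.append_assoc, List.cons_append, ← List.concat_eq_append]
        exact hBeq.symm
      obtain ⟨h3, -⟩ := List.append_inj' hr rfl
      have hr : r ∈ (ds N).reverse ++ [1] := by rw [← h3]; simp
      simp only [List.mem_append, List.mem_reverse, List.mem_singleton] at hr
      rcases hr with hr | hr
      · have := hds N r hr
        omega
      · omega
  · rw [prefixWord_blockSeq q ds h2, blockRuns, hy, List.append_assoc, hy, List.take_append,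
      length_runWord, htake, List.take_of_length_le (by rw [length_runWord]; omega)]

open Filter

/-! ### Hausdorff dimensions -/

theorem div_two_pow_antitone {m n : ℕ} (hm : 1 ≤ m) (h : m ≤ n) :
    (n : ℝ) / 2 ^ n ≤ m / 2 ^ m := by
  induction n, h using Nat.le_induction with
  | base => exact le_rfl
  | succ n hn ih =>
    refine le_trans ?_ ih
    rw [div_le_div_iff₀ (by positivity) (by positivity), pow_succ]
    have h1 : (1 : ℝ) ≤ n := by exact_mod_cast hm.trans hn
    have h2 : (0 : ℝ) < 2 ^ n := by positivity
    push_cast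
    nlinarith

/-- The quotient whose lower limit is the Hausdorff dimension. -/
noncomputable def logRatio (G : Subgroup AutT) (m : ℕ) : ℝ :=
  Real.log (cardMod G m) / Real.log (cardMod ⊤ m)

theorem hausdorffDim_eq_liminf (G : Subgroup AutT) : hausdorffDim G = liminf (logRatio G) atTop :=
  rfl

theorem logRatio_nonneg (G : Subgroup AutT) (m : ℕ) : 0 ≤ logRatio G m :=
  div_nonneg (Real.log_natCast_nonneg _) (Real.log_natCast_nonneg _)

theorem logRatio_of_cardMod {G : Subgroup AutT} {m l : ℕ} (h : cardMod G m = 2 ^ l) :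
    logRatio G m = l / (2 ^ m - 1) := by
  have h2 : Real.log 2 ≠ 0 := (Real.log_pos (by norm_num)).ne'
  rw [logRatio, h, cardMod_top]
  push_cast
  rw [Real.log_pow, Real.log_pow, mul_div_mul_right _ _ h2, Nat.cast_sub Nat.one_le_two_pow]
  push_cast
  rfl

theorem logRatio_of_runs {n : ℕ} {i₁ i₂ : Fin n} (hi : i₁ ≠ i₂) {w : ℕ → Bool} {m r t : ℕ}
    {x : Bool} {rs : List ℕ} (hrs : ∀ s ∈ rs, 1 ≤ s) (hr : 1 ≤ r) (ht : 1 ≤ t)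
    (hw : prefixWord m w = runWord x (rs ++ [r, t])) :
    logRatio (spinalGroup (coordSeq i₁ i₂ w)) (m + 1) =
      ((runRatio rs + 2 ^ r * (t + 1) + (r - 1)) / 2 ^ (r + t + 1) * 2 ^ (m + 1) + 3) /
        (2 ^ (m + 1) - 1) := by
  obtain ⟨r, rfl⟩ := Nat.exists_eq_add_of_le' hr
  obtain ⟨t, rfl⟩ := Nat.exists_eq_add_of_le' ht
  have hm : m = rs.sum + (r + 1 + (t + 1)) := by
    have := congrArg List.length hw
    rw [prefixWord_eq, List.length_map, List.length_range, length_runWord] at this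
    simpa using this
  have hcard := cardMod_spinalGroup hi w m
  rw [hw, card_finSpinal_runWord x hrs] at hcard
  rw [logRatio_of_cardMod hcard]
  congr 1
  rw [runRatio]
  push_cast
  have h1 : (2 : ℝ) ^ (m + 1) = 2 ^ rs.sum * 2 ^ (r + 1 + (t + 1) + 1) := by
    rw [hm, ← pow_add, add_assoc]
  rw [h1]
  field_simp
  ring

/-- The additive 3 and the missing 1 in the denominator only increase the quotient. -/
theorem le_logRatio_of_runs {n : ℕ} {i₁ i₂ : Fin n} (hi : i₁ ≠ i₂) {w : ℕ → Bool} {m r t : ℕ}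
    {x : Bool} {rs : List ℕ} (hrs : ∀ s ∈ rs, 1 ≤ s) (hr : 1 ≤ r) (ht : 1 ≤ t)
    (hw : prefixWord m w = runWord x (rs ++ [r, t])) :
    (runRatio rs + 2 ^ r * (t + 1) + (r - 1)) / 2 ^ (r + t + 1) ≤
      logRatio (spinalGroup (coordSeq i₁ i₂ w)) (m + 1) := by
  rw [logRatio_of_runs hi hrs hr ht hw]
  have h1 : (1 : ℝ) ≤ r := by exact_mod_cast hr
  have h2 : 0 ≤ (runRatio rs + 2 ^ r * (t + 1) + ((r : ℝ) - 1)) / 2 ^ (r + t + 1) := by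
    have := runRatio_nonneg rs
    have : (0 : ℝ) ≤ r - 1 := by linarith
    positivity
  have h3 : (2 : ℝ) ≤ 2 ^ (m + 1) := by
    rw [pow_succ]
    have : (1 : ℝ) ≤ 2 ^ m := one_le_pow₀ (by norm_num)
    linarith
  rw [le_div_iff₀ (by linarith)]
  nlinarith

/-- The main term `K` is at most 1, so the error `(K + 3) / (2 ^ (m + 1) - 1)` is at most `4 / 2 ^
m`. -/
theorem logRatio_le_of_runs {n : ℕ} {i₁ i₂ : Fin n} (hi : i₁ ≠ i₂) {w : ℕ → Bool} {m t : ℕ}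
    {x : Bool} {rs : List ℕ} (hrs : ∀ s ∈ rs, 1 ≤ s) (ht : 1 ≤ t)
    (hw : prefixWord m w = runWord x (rs ++ [1, t])) :
    logRatio (spinalGroup (coordSeq i₁ i₂ w)) (m + 1) ≤
      (runRatio rs + 2 * (t + 1)) / 2 ^ (t + 2) + 4 / 2 ^ m := by
  rw [logRatio_of_runs hi hrs le_rfl ht hw]
  have h3 : (1 : ℝ) ≤ 2 ^ m := one_le_pow₀ (by norm_num)
  set K := (runRatio rs + 2 * (t + 1)) / 2 ^ (t + 2) with hK
  have hK' : (runRatio rs + 2 ^ 1 * ((t : ℝ) + 1) + ((1 : ℕ) - 1)) / 2 ^ (1 + t + 1) = K := by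
    rw [hK, show 1 + t + 1 = t + 2 by ring]
    norm_num
  have hK1 : K ≤ 1 := by
    rw [hK, div_le_one (by positivity), pow_add]
    have h4 : (t : ℝ) + 1 ≤ 2 ^ t := by exact_mod_cast (Nat.lt_two_pow_self : t < 2 ^ t)
    have := runRatio_le_one hrs
    have : (1 : ℝ) ≤ t := by exact_mod_cast ht
    linarith
  rw [hK', pow_succ, div_le_iff₀ (by linarith)]
  have h4 : (4 : ℝ) / 2 ^ m * (2 ^ m * 2 - 1) = 8 - 4 / 2 ^ m := by
    field_simp
    ring
  have h5 : (4 : ℝ) / 2 ^ m ≤ 4 := div_le_self (by norm_num) h3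
  rw [add_mul, h4]
  linarith

/-! ### The lower limit along block sequences -/

section

variable {n q : ℕ} {i₁ i₂ : Fin n} {ds : ℕ → List ℕ} {x : ℝ}

theorem one_le_of_mem_append_reverse (hq : 3 ≤ q) (hds : ∀ k, ∀ d ∈ ds k, d = 1 ∨ d = 2) (N : ℕ) :
    ∀ s ∈ blockRuns q ds N ++ (ds N).reverse, 1 ≤ s := by
  intro s hs
  rcases List.mem_append.1 hs with hs | hs
  · exact one_le_of_mem_blockRuns hq hds hs
  · have := hds N s (List.mem_reverse.1 hs)
    omega

theorem abs_runRatio_sub_le (hq : 3 ≤ q) (hds : ∀ k, ∀ d ∈ ds k, d = 1 ∨ d = 2)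
    (hx : ∀ k v, 0 ≤ v → v ≤ 1 → |runMap (ds k) v - (2 + x) / 3| ≤ 1 / 2 ^ k) (N : ℕ) :
    |runRatio (blockRuns q ds N ++ (ds N).reverse) - (2 + x) / 3| ≤ 1 / 2 ^ N := by
  rw [runRatio_append_reverse]
  exact hx N _ (runRatio_nonneg _)
    (runRatio_le_one fun r hr => one_le_of_mem_blockRuns hq hds hr)

theorem le_logRatio_blockSeq (hi : i₁ ≠ i₂) (hq : 3 ≤ q)
    (hds : ∀ k, ∀ d ∈ ds k, d = 1 ∨ d = 2) (hx1 : x ≤ 1)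
    (hx : ∀ k v, 0 ≤ v → v ≤ 1 → |runMap (ds k) v - (2 + x) / 3| ≤ 1 / 2 ^ k) {N m : ℕ}
    (hN : 1 ≤ N) (h1 : (blockRuns q ds N).sum < m) (h2 : m ≤ (blockRuns q ds (N + 1)).sum) :
    ((2 + x) / 3 + 2 * (q + 1)) / 2 ^ (q + 2) - 1 / 2 ^ N ≤
      logRatio (spinalGroup (coordSeq i₁ i₂ (blockSeq q ds))) (m + 1) := by
  obtain ⟨ys, t, ht, hys, htq, hw⟩ := prefixWord_blockSeq_runs hq hds h1 h2
  have hpow : (0 : ℝ) < 1 / 2 ^ N := by positivity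
  rcases htq with htq | ⟨rfl, rfl⟩
  · obtain ⟨rs, r, hrs⟩ : ∃ rs r, blockRuns q ds N ++ ys = rs ++ [r] := by
      rcases List.eq_nil_or_concat (blockRuns q ds N ++ ys) with h | ⟨rs, r, h⟩
      · have := le_sum_blockRuns q ds N
        rw [(List.append_eq_nil_iff.1 h).1] at this
        simp at this
        omega
      · exact ⟨rs, r, by rw [h, List.concat_eq_append]⟩
    have hpos : ∀ s ∈ rs ++ [r], 1 ≤ s := by
      rw [← hrs]
      intro s hs
      exact (List.mem_append.1 hs).elim (one_le_of_mem_blockRuns hq hds) (hys s)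
    have hr : 1 ≤ r := hpos r (by simp)
    rw [hrs, List.append_assoc] at hw
    have h3 := le_logRatio_of_runs hi (fun s hs => hpos s (by simp [hs])) hr ht hw
    refine le_trans ?_ h3
    have hr' : (1 : ℝ) ≤ r := by exact_mod_cast hr
    -- Discarding the nonnegative terms other than `2 ^ r * (t + 1)` removes all dependence on the
    -- earlier runs.
    have h4 : ((t + 1 : ℕ) : ℝ) / 2 ^ (t + 1) ≤
        (runRatio rs + 2 ^ r * (t + 1) + (r - 1)) / 2 ^ (r + t + 1) := by
      rw [div_le_div_iff₀ (by positivity) (by positivity), add_assoc r, pow_add _ r]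
      have h5 : 0 ≤ (runRatio rs + ((r : ℝ) - 1)) * 2 ^ (t + 1) :=
        mul_nonneg (add_nonneg (runRatio_nonneg rs) (by linarith)) (by positivity)
      push_cast
      nlinarith
    have h6 := div_two_pow_antitone (m := t + 1) (n := q) (by omega) htq
    have h7 : ((2 + x) / 3 + 2 * ((q : ℝ) + 1)) / 2 ^ (q + 2) ≤ q / 2 ^ q := by
      rw [div_le_div_iff₀ (by positivity) (by positivity), pow_add]
      have h8 : (3 : ℝ) ≤ q := by exact_mod_cast hq
      have h9 : (0 : ℝ) < 2 ^ q := by positivity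
      nlinarith
    linarith
  · rw [← List.append_assoc, List.append_assoc _ [1]] at hw
    have h3 := le_logRatio_of_runs hi (one_le_of_mem_append_reverse hq hds N) le_rfl ht hw
    refine le_trans ?_ h3
    have h4 := (abs_le.1 (abs_runRatio_sub_le hq hds hx N)).1
    set ρ := runRatio (blockRuns t ds N ++ (ds N).reverse)
    have h5 : (ρ + 2 ^ 1 * ((t : ℝ) + 1) + ((1 : ℕ) - 1)) / 2 ^ (1 + t + 1) =
        (ρ + 2 * (t + 1)) / 2 ^ (t + 2) := by
      rw [show 1 + t + 1 = t + 2 by ring]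
      norm_num
    rw [h5]
    have h6 : (1 : ℝ) ≤ 2 ^ (t + 2) := one_le_pow₀ (by norm_num)
    have h7 : 1 / 2 ^ N / 2 ^ (t + 2) ≤ (1 : ℝ) / 2 ^ N := div_le_self hpow.le h6
    have h8 : ((2 + x) / 3 + 2 * ((t : ℝ) + 1)) / 2 ^ (t + 2) ≤
        (ρ + 2 * (t + 1)) / 2 ^ (t + 2) + 1 / 2 ^ N / 2 ^ (t + 2) := by
      rw [← add_div]
      exact div_le_div_of_nonneg_right (by linarith) (by positivity)
    linarith

/-- The end of the long run of block `N` is where the quotient comes near its lower limit; the 5 is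
1 from the approximation plus 4 from truncation. -/
theorem logRatio_blockSeq_le (hi : i₁ ≠ i₂) (hq : 3 ≤ q)
    (hds : ∀ k, ∀ d ∈ ds k, d = 1 ∨ d = 2)
    (hx : ∀ k v, 0 ≤ v → v ≤ 1 → |runMap (ds k) v - (2 + x) / 3| ≤ 1 / 2 ^ k) (N : ℕ) :
    logRatio (spinalGroup (coordSeq i₁ i₂ (blockSeq q ds))) ((blockRuns q ds (N + 1)).sum + 1) ≤
      ((2 + x) / 3 + 2 * (q + 1)) / 2 ^ (q + 2) + 5 / 2 ^ N := by
  set m := (blockRuns q ds (N + 1)).sum with hm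
  have hw : prefixWord m (blockSeq q ds) =
      runWord true (blockRuns q ds N ++ (ds N).reverse ++ [1, q]) := by
    rw [prefixWord_blockSeq q ds hm.le, List.take_of_length_le (by rw [length_runWord]),
      blockRuns, List.append_assoc]
  refine (logRatio_le_of_runs hi (one_le_of_mem_append_reverse hq hds N) (by omega) hw).trans ?_
  have h4 := (abs_le.1 (abs_runRatio_sub_le hq hds hx N)).2
  set ρ := runRatio (blockRuns q ds N ++ (ds N).reverse)
  have h6 : (1 : ℝ) ≤ 2 ^ (q + 2) := one_le_pow₀ (by norm_num)
  have h7 : 1 / 2 ^ N / 2 ^ (q + 2) ≤ (1 : ℝ) / 2 ^ N := div_le_self (by positivity) h6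
  have h8 : (ρ + 2 * ((q : ℝ) + 1)) / 2 ^ (q + 2) ≤
      ((2 + x) / 3 + 2 * (q + 1)) / 2 ^ (q + 2) + 1 / 2 ^ N / 2 ^ (q + 2) := by
    rw [← add_div]
    exact div_le_div_of_nonneg_right (by linarith) (by positivity)
  have h9 : (4 : ℝ) / 2 ^ m ≤ 4 / 2 ^ N := by
    have : N ≤ m := (Nat.le_succ N).trans (le_sum_blockRuns q ds (N + 1))
    gcongr
    norm_num
  have h10 : (5 : ℝ) / 2 ^ N = 1 / 2 ^ N + 4 / 2 ^ N := by ring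
  linarith

theorem exists_div_two_pow_lt {ε : ℝ} (hε : 0 < ε) (c : ℝ) : ∃ N₀ : ℕ, ∀ N ≥ N₀, c / 2 ^ N < ε := by
  have h : Tendsto (fun N : ℕ => c / (2 : ℝ) ^ N) atTop (nhds 0) :=
    tendsto_const_nhds.div_atTop (tendsto_pow_atTop_atTop_of_one_lt (by norm_num))
  exact eventually_atTop.1 (h.eventually (gt_mem_nhds hε))

theorem hausdorffDim_blockSeq (hi : i₁ ≠ i₂) (hq : 3 ≤ q)
    (hds : ∀ k, ∀ d ∈ ds k, d = 1 ∨ d = 2) (hx1 : x ≤ 1)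
    (hx : ∀ k v, 0 ≤ v → v ≤ 1 → |runMap (ds k) v - (2 + x) / 3| ≤ 1 / 2 ^ k) :
    hausdorffDim (spinalGroup (coordSeq i₁ i₂ (blockSeq q ds))) =
      ((2 + x) / 3 + 2 * (q + 1)) / 2 ^ (q + 2) := by
  rw [hausdorffDim_eq_liminf]
  set u := logRatio (spinalGroup (coordSeq i₁ i₂ (blockSeq q ds)))
  set l := ((2 + x) / 3 + 2 * ((q : ℝ) + 1)) / 2 ^ (q + 2)
  have hupper : ∀ ε > 0, ∃ᶠ m in atTop, u m ≤ l + ε := by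
    intro ε hε
    obtain ⟨N₀, hN₀⟩ := exists_div_two_pow_lt hε 5
    refine frequently_atTop.2 fun M => ?_
    refine ⟨_, ?_, (logRatio_blockSeq_le hi hq hds hx (max N₀ M)).trans
      (add_le_add le_rfl (hN₀ _ (le_max_left _ _)).le)⟩
    have := le_sum_blockRuns q ds (max N₀ M + 1)
    have := le_max_right N₀ M
    omega
  have hlower : ∀ ε > 0, ∀ᶠ m in atTop, l - ε ≤ u m := by
    intro ε hε
    obtain ⟨N₀, hN₀⟩ := exists_div_two_pow_lt hε 1
    refine eventually_atTop.2 ⟨(blockRuns q ds (N₀ + 1)).sum + 2, fun m hm => ?_⟩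
    obtain ⟨m, rfl⟩ := Nat.exists_eq_add_of_le' (show 2 ≤ m by omega)
    obtain ⟨N, h1, h2⟩ := exists_block (q := q) ds m
    have hN : N₀ + 1 ≤ N := by
      by_contra h
      have hle := (blockRuns_prefix q ds (show N + 1 ≤ N₀ + 1 by omega)).length_le
      rw [length_runWord, length_runWord] at hle
      omega
    have h3 := le_logRatio_blockSeq hi hq hds hx1 hx (m := m + 1) (by omega)
      (Nat.lt_succ_of_le h1) h2
    have h4 := hN₀ N (by omega)
    exact le_trans (by linarith) h3
  apply le_antisymm
  · refine le_of_forall_pos_le_add fun ε hε => ?_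
    exact liminf_le_of_frequently_le (hupper ε hε)
      (isBoundedUnder_of ⟨0, fun m => logRatio_nonneg _ m⟩)
  · refine le_of_forall_pos_le_add fun ε hε => ?_
    -- The frequent upper bound, with `ε = 1`, supplies the coboundedness required for a real lower
    -- limit.
    have := le_liminf_of_le
      (IsCoboundedUnder.of_frequently_le (hupper 1 one_pos)) (hlower ε hε)
    linarith

end

/-! ### The dimension of the span of the letters -/

theorem shift_iterate_coordSeq {n : ℕ} (i₁ i₂ : Fin n) (w : ℕ → Bool) (k : ℕ) :
    shift^[k] (coordSeq i₁ i₂ w) = coordSeq i₁ i₂ (fun i => w (i + k)) := by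
  induction k generalizing w with
  | zero => rfl
  | succ k ih =>
    rw [Function.iterate_succ_apply, shift_coordSeq, ih]
    rfl

theorem linearIndependent_proj_pair {n : ℕ} {i₁ i₂ : Fin n} (hi : i₁ ≠ i₂) :
    LinearIndependent (ZMod 2) ![(LinearMap.proj i₁ : Module.Dual (ZMod 2) (LevelGroup n)),
      LinearMap.proj i₂] := by
  rw [LinearIndependent.pair_iff]
  intro s t h
  have h1 := LinearMap.congr_fun h (Pi.single i₁ 1)
  have h2 := LinearMap.congr_fun h (Pi.single i₂ 1)
  simp [hi, hi.symm] at h1 h2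
  exact ⟨h1, h2⟩

theorem diminf_coordSeq {n : ℕ} {i₁ i₂ : Fin n} (hi : i₁ ≠ i₂) {w : ℕ → Bool}
    (hw : ∀ k x, ∃ i, k ≤ i ∧ w i = x) : diminf (coordSeq i₁ i₂ w) = 2 := by
  have key : ∀ k, limUnder atTop (fun m => dimMod (shift^[k] (coordSeq i₁ i₂ w)) m) = 2 := by
    intro k
    rw [shift_iterate_coordSeq]
    obtain ⟨a, ha, hat⟩ := hw k true
    obtain ⟨b, hb, hbf⟩ := hw k false
    refine Tendsto.limUnder_eq (tendsto_const_nhds.congr' ?_)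
    filter_upwards [eventually_ge_atTop (a + b + 2)] with m hm
    have hset : {φ | ∃ i : ℕ, i + 1 < m ∧ φ = (coordSeq i₁ i₂ (fun i => w (i + k))).1 i} =
        Set.range ![(LinearMap.proj i₁ : Module.Dual (ZMod 2) (LevelGroup n)),
          LinearMap.proj i₂] := by
      ext φ
      simp only [Matrix.range_cons, Matrix.range_empty, Set.union_empty, Set.mem_union,
        Set.mem_singleton_iff]
      constructor
      · rintro ⟨i, -, rfl⟩
        cases h : w (i + k) <;> simp [coordSeq, h]
      · rintro (rfl | rfl)
        · refine ⟨a - k, by omega, ?_⟩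
          simp [coordSeq, Nat.sub_add_cancel ha, hat]
        · refine ⟨b - k, by omega, ?_⟩
          simp [coordSeq, Nat.sub_add_cancel hb, hbf]
    rw [dimMod, hset, finrank_span_eq_card (linearIndependent_proj_pair hi)]
    rfl
  rw [diminf]
  simp only [key, liminf_const]

/-! ### The affine images and their disjointness -/

theorem mem_dimSet_of_mem_quarterCantor {n : ℕ} (hn : 2 ≤ n) {q : ℕ} (hq : 3 ≤ q) {x : ℝ}
    (hx : x ∈ quarterCantor) : ((2 + x) / 3 + 2 * (q + 1)) / 2 ^ (q + 2) ∈ dimSet n := by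
  choose ds hds hnear using exists_runMap_near hx
  have hi : (⟨0, by omega⟩ : Fin n) ≠ ⟨1, by omega⟩ := by simp
  exact ⟨_, diminf_coordSeq hi fun k x => exists_blockSeq_eq (by omega) ds k x,
    hausdorffDim_blockSeq hi hq hds (quarterCantor_subset hx).2 hnear⟩

end Spinal

theorem theorem5p1 (n : ℕ) (hn : 2 ≤ n) :
    ∃ p q : ℕ → ℚ,
      (∀ i, p i ≠ 0) ∧
      (∀ i, (fun x : ℝ => (p i : ℝ) * x + (q i : ℝ)) '' Spinal.quarterCantor ⊆ Spinal.dimSet n) ∧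
      (∀ i j, i ≠ j →
        Disjoint ((fun x : ℝ => (p i : ℝ) * x + (q i : ℝ)) '' Spinal.quarterCantor)
          ((fun x : ℝ => (p j : ℝ) * x + (q j : ℝ)) '' Spinal.quarterCantor)) := by
  -- The `i`-th map corresponds to long runs of length `q = i + 3`.
  have hval : ∀ (i : ℕ) (x : ℝ), ((1 / (3 * 2 ^ (i + 5)) : ℚ) : ℝ) * x +
      ((2 / 3 + 2 * (i + 4)) / 2 ^ (i + 5) : ℚ) =
        ((2 + x) / 3 + 2 * ((i + 3 : ℕ) + 1)) / 2 ^ (i + 3 + 2) := by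
    intro i x
    push_cast
    field_simp
    ring
  refine ⟨fun i => 1 / (3 * 2 ^ (i + 5)), fun i => (2 / 3 + 2 * (i + 4)) / 2 ^ (i + 5),
    fun i => by positivity, ?_, ?_⟩
  · rintro i _ ⟨x, hx, rfl⟩
    dsimp only
    rw [hval]
    exact Spinal.mem_dimSet_of_mem_quarterCantor hn (by omega) hx
  -- Larger `q` gives strictly smaller values, whatever the points of the Cantor set; the comparison
  -- is the monotonicity of `n / 2 ^ n` from `i + 5` to `j + 4`.
  · have hlt : ∀ i j : ℕ, i < j → ∀ x ∈ Spinal.quarterCantor, ∀ y ∈ Spinal.quarterCantor,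
        ((2 + y) / 3 + 2 * (((j + 3 : ℕ) : ℝ) + 1)) / 2 ^ (j + 3 + 2) <
          ((2 + x) / 3 + 2 * ((i + 3 : ℕ) + 1)) / 2 ^ (i + 3 + 2) := by
      intro i j hij x hx y hy
      have hx0 := (Spinal.quarterCantor_subset hx).1
      have hy1 := (Spinal.quarterCantor_subset hy).2
      have h1 := Spinal.div_two_pow_antitone (m := i + 5) (n := j + 4) (by omega) (by omega)
      calc ((2 + y) / 3 + 2 * (((j + 3 : ℕ) : ℝ) + 1)) / 2 ^ (j + 3 + 2)
          ≤ (1 + 2 * (((j + 3 : ℕ) : ℝ) + 1)) / 2 ^ (j + 3 + 2) :=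
            div_le_div_of_nonneg_right (by linarith) (by positivity)
        _ = ((j + 4 : ℕ) : ℝ) / 2 ^ (j + 4) + 1 / 2 ^ (j + 5) := by
            push_cast
            field_simp
            ring
        _ ≤ ((i + 5 : ℕ) : ℝ) / 2 ^ (i + 5) + 1 / 2 ^ (i + 5) := by
            have h2 : (1 : ℝ) / 2 ^ (j + 5) ≤ 1 / 2 ^ (i + 5) :=
              one_div_le_one_div_of_le (by positivity)
                (pow_le_pow_right₀ (by norm_num) (by omega))
            linarith
        _ < ((2 + x) / 3 + 2 * ((i + 3 : ℕ) + 1)) / 2 ^ (i + 3 + 2) := by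
            rw [← add_div]
            refine div_lt_div_of_pos_right ?_ (by positivity)
            push_cast
            have hi : (0 : ℝ) ≤ i := Nat.cast_nonneg i
            linarith
    intro i j hij
    rw [Set.disjoint_left]
    rintro _ ⟨x, hx, rfl⟩ ⟨y, hy, h⟩
    dsimp only at h
    rw [hval, hval] at h
    rcases hij.lt_or_gt with hij | hij
    · exact (hlt i j hij x hx y hy).ne h
    · exact (hlt j i hij y hy x hx).ne' h
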